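/- **Setting.** Let $f:\mathbb R^d\to\mathbb R$ be twice differentiable with $\inf f=f^*>-\infty$, and let the coordinates be split into two nonempty blocks, $\mathbf x=(\mathbf x_1,\mathbf x_2)$, with partial gradients $\nabla_1 f,\nabla_2 f$. Assume that $f$ is $L$-smooth ($\nabla f$ is $L$-Lipschitz), that $\nabla_k f$ is $L_k$-Lipschitz in $\mathbf x_k$ for fixed other block and $\widetilde L_k$-Lipschitz in the other block for fixed $\mathbf x_k$ ($k=1,2$), and that $\nabla^2 f$ is $\rho$-Lipschitz in operator norm, $\rho>0$. Put $L_{\max}=\max\{L_1,L_2,\widetilde L_1,\widetilde L_2\}$ and assume $0<L_{\max}\le L$. **Algorithm (PA-GD).** Given $\mathbf x^{(0)}$, $\epsilon>0$, $\delta\in(0,1]$, $c>0$, put $\Delta_f=f(\mathbf x^{(0)})-f^*$, $\mathcal P_1=1+\frac{L}{L_{\max}}$, $\mathcal P_2=1+\frac{L\log(2d)}{L_{\max}}$, $$\ell=\log\Big(\frac{\mathcal P_1^6\mathcal P_2^2\,d\,L_{\max}^{5/3}\Delta_f}{c^5\rho^{1/3}\epsilon^{7/3}\delta}\Big),\quad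 \chi=6\max\{\ell,4\},\quad \eta=\frac{c}{L_{\max}},\quad r=\frac{c^3}{\chi^3}\frac{\epsilon}{L_{\max}\mathcal P_1^3\mathcal P_2},$$ $$g_{\rm th}=\frac{c^2\epsilon}{(\chi\mathcal P_1)^3\mathcal P_2},\quad f_{\rm th}=\frac{c^5\epsilon^2}{L_{\max}(\chi\mathcal P_1)^6\mathcal P_2^2},\quad t_{\rm th}=\frac{L_{\max}\chi\mathcal P_1}{c^2(L_{\max}\rho\epsilon)^{1/3}}$$ (if $\Delta_f=0$, then $\max\{\ell,4\}=4$). In iteration $t=0,1,2,\dots$ with current iterate $\mathbf x=\mathbf x^{(t)}$: (i) if $\|\nabla_1 f(\mathbf x_1,\mathbf x_2)\|^2+\|\nabla_2 f(\mathbf x_1-\eta\nabla_1f(\mathbf x),\mathbf x_2)\|^2\le g_{\rm th}^2$ and either no perturbation has been made yet or $t-t_{\rm p}>\lceil t_{\rm th}\rceil$, then set $\widetilde{\mathbf x}\leftarrow\mathbf x$, $t_{\rm p}\leftarrow t$ and $\mathbf x\leftarrow\widetilde{\mathbf x}+\xi^{(t)}$, where the $\xi^{(t)}$ are independent and uniform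 on the ball of radius $r$ centered at $0$; (ii) if a perturbation has been made, $t-t_{\rm p}=\lceil t_{\rm th}\rceil$ and $f(\mathbf x)-f(\widetilde{\mathbf x})>-f_{\rm th}$, return $\widetilde{\mathbf x}$ and stop; (iii) otherwise update $\mathbf x_1\leftarrow\mathbf x_1-\eta\nabla_1 f(\mathbf x_1,\mathbf x_2)$, then $\mathbf x_2\leftarrow\mathbf x_2-\eta\nabla_2 f(\mathbf x_1,\mathbf x_2)$ with the new $\mathbf x_1$; the result is $\mathbf x^{(t+1)}$. **Theorem.** There is an absolute constant $c_{\max}>0$, and for every $0<c\le c_{\max}$ a constant $C>0$ depending only on $c$, such that in the above setting, for all $\mathbf x^{(0)}$, all $\delta\in(0,1]$ and all $0<\epsilon\le L_{\max}^2/\rho$, with probability at least $1-\delta$ PA-GD stops and returns a point $\mathbf x$ with $$\|\nabla f(\mathbf x)\|\le\epsilon\quad\text{and}\quad\lambda_{\min}(\nabla^2 f(\mathbf x))\ge-(L_{\max}\rho\epsilon)^{1/3},$$ after a number $T$ of iterations satisfying $$T\le C\left(\frac{L_{\max}^{5/3}\mathcal P_1^7\mathcal P_2^2\Delta_f}{\rho^{1/3}\epsilon^{7/3}}\max\{\ell,4\}^7+t_{\rm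 th}\right);$$ in particular, if moreover $\Delta_f\ge\epsilon^2/L_{\max}$, then $$T\le C\,\frac{L_{\max}^{5/3}\mathcal P_1^7\mathcal P_2^2\Delta_f}{\rho^{1/3}\epsilon^{7/3}}\,\log^7\Big(\frac{\mathcal P_1^6\mathcal P_2^2\,d\,L_{\max}^{5/3}\Delta_f}{c^5\rho^{1/3}\epsilon^{7/3}\delta}\Big).$$ -/

import Mathlib

open MeasureTheory ProbabilityTheory

/-! ### Two-block structure and regularity of the objective -/

/-- The `k`-th block of `x`, padded with zeros. The map `blk` assigns each coordinate to one of the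
two blocks, `0` (first) and `1` (second). -/
noncomputable def blockPart {d : ℕ} (blk : Fin d → Fin 2) (k : Fin 2)
    (x : EuclideanSpace ℝ (Fin d)) : EuclideanSpace ℝ (Fin d) :=
  WithLp.toLp 2 (fun i => if blk i = k then x i else 0)

/-- The partial gradient of `f` in block `k` at `x` (padded with zeros). -/
noncomputable def blockGrad {d : ℕ} (blk : Fin d → Fin 2) (f : EuclideanSpace ℝ (Fin d) → ℝ)
    (k : Fin 2) (x : EuclideanSpace ℝ (Fin d)) : EuclideanSpace ℝ (Fin d) :=
  blockPart blk k (gradient f x)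

/-- The Hessian of `f` at `x`, as a linear operator. -/
noncomputable def hessian {d : ℕ} (f : EuclideanSpace ℝ (Fin d) → ℝ)
    (x : EuclideanSpace ℝ (Fin d)) : EuclideanSpace ℝ (Fin d) →L[ℝ] EuclideanSpace ℝ (Fin d) :=
  fderiv ℝ (gradient f) x

/-- `f` is `L`-smooth. -/
def IsLSmooth {d : ℕ} (f : EuclideanSpace ℝ (Fin d) → ℝ) (L : ℝ) : Prop :=
  Differentiable ℝ f ∧ ∀ x y, ‖gradient f x - gradient f y‖ ≤ L * ‖x - y‖

/-- `f` is block-wise smooth: the `k`-th partial gradient is `Lb k`-Lipschitz in the `k`-th block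
(the other block being fixed) and `Lt k`-Lipschitz in the other block (the `k`-th being fixed). -/
def IsBlockSmooth {d : ℕ} (blk : Fin d → Fin 2) (f : EuclideanSpace ℝ (Fin d) → ℝ)
    (Lb Lt : Fin 2 → ℝ) : Prop :=
  Differentiable ℝ f ∧
  (∀ (k : Fin 2) (x y : EuclideanSpace ℝ (Fin d)), (∀ i, blk i ≠ k → x i = y i) →
    ‖blockGrad blk f k x - blockGrad blk f k y‖ ≤ Lb k * ‖x - y‖) ∧
  (∀ (k : Fin 2) (x y : EuclideanSpace ℝ (Fin d)), (∀ i, blk i = k → x i = y i) →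
    ‖blockGrad blk f k x - blockGrad blk f k y‖ ≤ Lt k * ‖x - y‖)

/-- `f` is twice differentiable with `ρ`-Lipschitz Hessian (in operator norm). -/
def IsHessianLipschitz {d : ℕ} (f : EuclideanSpace ℝ (Fin d) → ℝ) (ρ : ℝ) : Prop :=
  Differentiable ℝ f ∧ Differentiable ℝ (gradient f) ∧
    ∀ x y, ‖hessian f x - hessian f y‖ ≤ ρ * ‖x - y‖

/-- The largest of the four block-wise Lipschitz constants. -/
noncomputable def blockLmax (Lb Lt : Fin 2 → ℝ) : ℝ :=
  max (max (Lb 0) (Lb 1)) (max (Lt 0) (Lt 1))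

/-- `x` is an `(ε, γ)`-second-order stationary point: `‖∇f(x)‖ ≤ ε` and `λ_min(∇²f(x)) ≥ -γ`,
i.e. every eigenvalue of the Hessian is at least `-γ`. -/
def IsSS2 {d : ℕ} (f : EuclideanSpace ℝ (Fin d) → ℝ) (ε γ : ℝ)
    (x : EuclideanSpace ℝ (Fin d)) : Prop :=
  ‖gradient f x‖ ≤ ε ∧
    ∀ μ : ℝ, Module.End.HasEigenvalue
      (hessian f x : EuclideanSpace ℝ (Fin d) →ₗ[ℝ] EuclideanSpace ℝ (Fin d)) μ → -γ ≤ μ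

/-! ### The algorithm -/

/-- The input parameters of perturbed alternating gradient descent; `Δ` is the initial
optimality gap. -/
structure PAGDParams where
  d : ℕ
  c : ℝ
  Lmax : ℝ
  L : ℝ
  ρ : ℝ
  ε : ℝ
  δ : ℝ
  Δ : ℝ

namespace PAGDParams

noncomputable def P₁ (p : PAGDParams) : ℝ := 1 + p.L / p.Lmax

noncomputable def P₂ (p : PAGDParams) : ℝ := 1 + p.L * Real.log (2 * (p.d : ℝ)) / p.Lmax

/-- The curvature tolerance `γ = (L_max ρ ε)^{1/3}`. -/
noncomputable def γ (p : PAGDParams) : ℝ := (p.Lmax * p.ρ * p.ε) ^ ((1 : ℝ) / 3)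

/-- The logarithm of `P₁⁶ P₂² d L_max^{5/3} Δ / (c⁵ ρ^{1/3} ε^{7/3} δ)`. -/
noncomputable def logFactor (p : PAGDParams) : ℝ :=
  Real.log (p.P₁ ^ 6 * p.P₂ ^ 2 * (p.d : ℝ) * p.Lmax ^ ((5 : ℝ) / 3) * p.Δ /
    (p.c ^ 5 * p.ρ ^ ((1 : ℝ) / 3) * p.ε ^ ((7 : ℝ) / 3) * p.δ))

noncomputable def χ (p : PAGDParams) : ℝ := 6 * max p.logFactor 4

/-- The step size. -/
noncomputable def η (p : PAGDParams) : ℝ := p.c / p.Lmax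

/-- The perturbation radius. -/
noncomputable def r (p : PAGDParams) : ℝ :=
  p.c ^ 3 / p.χ ^ 3 * (p.ε / (p.Lmax * p.P₁ ^ 3 * p.P₂))

/-- The gradient threshold. -/
noncomputable def gth (p : PAGDParams) : ℝ :=
  p.c ^ 2 * p.ε / ((p.χ * p.P₁) ^ 3 * p.P₂)

/-- The objective threshold. -/
noncomputable def fth (p : PAGDParams) : ℝ :=
  p.c ^ 5 * p.ε ^ 2 / (p.Lmax * (p.χ * p.P₁) ^ 6 * p.P₂ ^ 2)

/-- The time threshold, as a real number. The algorithm uses it rounded up. -/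
noncomputable def tth (p : PAGDParams) : ℝ :=
  p.Lmax * p.χ * p.P₁ / (p.c ^ 2 * p.γ)

/-- The factor `L_max^{5/3} P₁⁷ P₂² Δ / (ρ^{1/3} ε^{7/3})` of the iteration bound. -/
noncomputable def rate (p : PAGDParams) : ℝ :=
  p.Lmax ^ ((5 : ℝ) / 3) * p.P₁ ^ 7 * p.P₂ ^ 2 * p.Δ /
    (p.ρ ^ ((1 : ℝ) / 3) * p.ε ^ ((7 : ℝ) / 3))

end PAGDParams

/-- A state of the algorithm at the beginning of an iteration: the current iterate `x`, and, if a
perturbation has already been made, the time `t_p` of the last one together with the iterate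
before that perturbation. -/
structure PAGDState (d : ℕ) where
  x : EuclideanSpace ℝ (Fin d)
  last : Option (ℕ × EuclideanSpace ℝ (Fin d))

/-- The iterate after the update of the first block. -/
noncomputable def agdHalf {d : ℕ} (blk : Fin d → Fin 2) (f : EuclideanSpace ℝ (Fin d) → ℝ)
    (η : ℝ) (x : EuclideanSpace ℝ (Fin d)) : EuclideanSpace ℝ (Fin d) :=
  x - η • blockGrad blk f 0 x

/-- One step of alternating gradient descent: first block, then second block at the updated
first block. -/
noncomputable def agdStep {d : ℕ} (blk : Fin d → Fin 2) (f : EuclideanSpace ℝ (Fin d) → ℝ)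
    (η : ℝ) (x : EuclideanSpace ℝ (Fin d)) : EuclideanSpace ℝ (Fin d) :=
  agdHalf blk f η x - η • blockGrad blk f 1 (agdHalf blk f η x)

/-- The sum of the squared norms of the two partial gradients that an alternating step at `x`
uses. -/
noncomputable def agdGradSq {d : ℕ} (blk : Fin d → Fin 2) (f : EuclideanSpace ℝ (Fin d) → ℝ)
    (η : ℝ) (x : EuclideanSpace ℝ (Fin d)) : ℝ :=
  ‖blockGrad blk f 0 x‖ ^ 2 + ‖blockGrad blk f 1 (agdHalf blk f η x)‖ ^ 2

open Classical in
/-- The perturbation part of iteration `t`, with noise `ξ`: it acts if the partial gradients are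
small and more than `t_th` iterations have passed since the last perturbation (or there was
none). -/
noncomputable def pagdPerturb {d : ℕ} (p : PAGDParams) (blk : Fin d → Fin 2)
    (f : EuclideanSpace ℝ (Fin d) → ℝ) (t : ℕ) (ξ : EuclideanSpace ℝ (Fin d))
    (s : PAGDState d) : PAGDState d :=
  if agdGradSq blk f p.η s.x ≤ p.gth ^ 2 ∧ ∀ q ∈ s.last, q.1 + ⌈p.tth⌉₊ < t then
    ⟨s.x + ξ, some (t, s.x)⟩
  else s

open Classical in
/-- Iteration `t`, with noise `ξ`: possible perturbation, then the stopping test (`t_th` iterations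
after the last perturbation), then an alternating gradient step. The result is either the next
state or the returned point. -/
noncomputable def pagdIter {d : ℕ} (p : PAGDParams) (blk : Fin d → Fin 2)
    (f : EuclideanSpace ℝ (Fin d) → ℝ) (t : ℕ) (ξ : EuclideanSpace ℝ (Fin d))
    (s : PAGDState d) : PAGDState d ⊕ EuclideanSpace ℝ (Fin d) :=
  match (pagdPerturb p blk f t ξ s).last with
  | some (tp, xt) =>
    if t = tp + ⌈p.tth⌉₊ ∧ -p.fth < f (pagdPerturb p blk f t ξ s).x - f xt then
      Sum.inr xt
    else Sum.inl ⟨agdStep blk f p.η (pagdPerturb p blk f t ξ s).x, some (tp, xt)⟩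
  | none => Sum.inl ⟨agdStep blk f p.η (pagdPerturb p blk f t ξ s).x, none⟩

/-- The algorithm started at `x₀` with noise sequence `ξ`, after `T` iterations: either it is still
running, in some state, or it has returned a point. -/
noncomputable def pagdRun {d : ℕ} (p : PAGDParams) (blk : Fin d → Fin 2)
    (f : EuclideanSpace ℝ (Fin d) → ℝ) (x₀ : EuclideanSpace ℝ (Fin d))
    (ξ : ℕ → EuclideanSpace ℝ (Fin d)) : ℕ → PAGDState d ⊕ EuclideanSpace ℝ (Fin d)
  | 0 => Sum.inl ⟨x₀, none⟩
  | t + 1 =>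
    match pagdRun p blk f x₀ ξ t with
    | Sum.inl s => pagdIter p blk f t (ξ t) s
    | Sum.inr y => Sum.inr y

/-- The uniform distribution on the ball of radius `r` centered at the origin. -/
noncomputable def uniformBall (d : ℕ) (r : ℝ) : Measure (EuclideanSpace ℝ (Fin d)) :=
  cond volume (Metric.ball 0 r)

open scoped RealInnerProductSpace

theorem sq_norm_sub_le_of_drop {E : Type*} [NormedAddCommGroup E] (z : ℕ → E) (Q : ℕ → ℝ) {B : ℝ}
    (h : ∀ n, ‖z (n + 1) - z n‖ ^ 2 ≤ B * (Q n - Q (n + 1))) (n : ℕ) :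
    ‖z n - z 0‖ ^ 2 ≤ n * (B * (Q 0 - Q n)) := by
  have h1 : ‖z n - z 0‖ ≤ ∑ i ∈ Finset.range n, ‖z (i + 1) - z i‖ := by
    rw [← Finset.sum_range_sub]
    exact norm_sum_le _ _
  have h2 : (∑ i ∈ Finset.range n, ‖z (i + 1) - z i‖) ^ 2 ≤
      n * ∑ i ∈ Finset.range n, ‖z (i + 1) - z i‖ ^ 2 := by
    simpa using sq_sum_le_card_mul_sum_sq (s := Finset.range n) (f := fun i => ‖z (i + 1) - z i‖)
  have h3 : ∑ i ∈ Finset.range n, ‖z (i + 1) - z i‖ ^ 2 ≤ B * (Q 0 - Q n) := by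
    rw [← Finset.sum_range_sub' Q n, Finset.mul_sum]
    exact Finset.sum_le_sum fun i _ => h i
  calc ‖z n - z 0‖ ^ 2 ≤ _ := pow_le_pow_left₀ (norm_nonneg _) h1 2
    _ ≤ _ := h2
    _ ≤ _ := by gcongr

/-- `p` and `q` are complementary orthogonal projections. -/
structure IsBlockSplit {E : Type*} [NormedAddCommGroup E] [InnerProductSpace ℝ E]
    (p q : E →L[ℝ] E) : Prop where
  inner_left : ∀ x y, ⟪p x, y⟫ = ⟪x, p y⟫
  inner_right : ∀ x y, ⟪q x, y⟫ = ⟪x, q y⟫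
  left_left : ∀ x, p (p x) = p x
  left_right : ∀ x, p (q x) = 0
  right_left : ∀ x, q (p x) = 0
  right_right : ∀ x, q (q x) = q x
  add_eq : ∀ x, p x + q x = x

namespace IsBlockSplit

variable {E : Type*} [NormedAddCommGroup E] [InnerProductSpace ℝ E] {p q : E →L[ℝ] E}

theorem symm (h : IsBlockSplit p q) : IsBlockSplit q p :=
  ⟨h.inner_right, h.inner_left, h.right_right, h.right_left, h.left_right, h.left_left,
    fun x => by rw [add_comm, h.add_eq]⟩

theorem inner_left_right (h : IsBlockSplit p q) (x y : E) : ⟪p x, q y⟫ = 0 := by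
  rw [h.inner_left, h.left_right, inner_zero_right]

theorem sq_norm_comb (h : IsBlockSplit p q) (x y : E) :
    ‖p x + q y‖ ^ 2 = ‖p x‖ ^ 2 + ‖q y‖ ^ 2 := by
  rw [norm_add_sq_real, h.inner_left_right]; ring

theorem sq_norm_eq (h : IsBlockSplit p q) (x : E) : ‖x‖ ^ 2 = ‖p x‖ ^ 2 + ‖q x‖ ^ 2 := by
  rw [← h.sq_norm_comb, h.add_eq]

theorem norm_left_le (h : IsBlockSplit p q) (x : E) : ‖p x‖ ≤ ‖x‖ := by
  have := h.sq_norm_eq x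
  exact (sq_le_sq₀ (norm_nonneg _) (norm_nonneg _)).1 (by nlinarith [sq_nonneg ‖q x‖])

theorem norm_right_le (h : IsBlockSplit p q) (x : E) : ‖q x‖ ≤ ‖x‖ := h.symm.norm_left_le x

theorem inner_left_self (h : IsBlockSplit p q) (x y : E) : ⟪p x, p y⟫ = ⟪x, p y⟫ := by
  rw [h.inner_left, h.left_left]

end IsBlockSplit

section

variable {E : Type*} [NormedAddCommGroup E] [InnerProductSpace ℝ E] {p q : E →L[ℝ] E}

/-- The alternating gradient step for the quadratic form with matrix `H`. -/
noncomputable def altStep (p q H : E →L[ℝ] E) (η : ℝ) : E →L[ℝ] E :=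
  (1 - η • (q * H)) * (1 - η • (p * H))

theorem altStep_apply (p q H : E →L[ℝ] E) (η : ℝ) (v : E) :
    altStep p q H η v = (v - η • p (H v)) - η • q (H (v - η • p (H v))) := by
  simp [altStep]

/-- The symmetric matrix with the diagonal blocks of `H` shifted by `b` and its off-diagonal
blocks scaled by `σ`. -/
noncomputable def scaledBlock (p q H : E →L[ℝ] E) (σ b : ℝ) : E →L[ℝ] E :=
  p * H * p + q * H * q + σ • (p * H * q + q * H * p) + b • 1

theorem scaledBlock_apply (p q H : E →L[ℝ] E) (σ b : ℝ) (z : E) :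
    scaledBlock p q H σ b z =
      p (H (p z)) + q (H (q z)) + σ • (p (H (q z)) + q (H (p z))) + b • z := by
  simp [scaledBlock]

theorem inner_scaledBlock_comm (hs : IsBlockSplit p q) {H : E →L[ℝ] E}
    (hH : ∀ x y, ⟪H x, y⟫ = ⟪x, H y⟫) (σ b : ℝ) (x y : E) :
    ⟪scaledBlock p q H σ b x, y⟫ = ⟪x, scaledBlock p q H σ b y⟫ := by
  simp only [scaledBlock_apply, inner_add_left, inner_add_right, real_inner_smul_left,
    real_inner_smul_right, hs.inner_left, hs.inner_right, hH]
  ring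

theorem inner_scaledBlock_self (hs : IsBlockSplit p q) {H : E →L[ℝ] E} (σ b : ℝ) (z : E) :
    ⟪z, scaledBlock p q H σ b z⟫ =
      σ * ⟪z, H z⟫ + (1 - σ) * (⟪p z, H (p z)⟫ + ⟪q z, H (q z)⟫) + b * ‖z‖ ^ 2 := by
  have : ⟪z, H z⟫ = ⟪p z, H (p z)⟫ + ⟪p z, H (q z)⟫ + ⟪q z, H (p z)⟫ + ⟪q z, H (q z)⟫ := by
    conv_lhs => rw [← hs.add_eq z]
    simp only [map_add, inner_add_left, inner_add_right]; ring
  rw [this]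
  simp only [scaledBlock_apply, inner_add_right, real_inner_smul_right, ← hs.inner_left,
    ← hs.inner_right, real_inner_self_eq_norm_sq]
  ring

theorem abs_inner_le {H : E →L[ℝ] E} {Λ : ℝ} (hΛ : ∀ x, ‖H x‖ ≤ Λ * ‖x‖) (z : E) :
    |⟪z, H z⟫| ≤ Λ * ‖z‖ ^ 2 :=
  (abs_real_inner_le_norm _ _).trans (by nlinarith [hΛ z, norm_nonneg z])

theorem abs_inner_blocks_le (hs : IsBlockSplit p q) {H : E →L[ℝ] E} {Λ : ℝ}
    (hΛ : ∀ x, ‖H x‖ ≤ Λ * ‖x‖) (z : E) :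
    |⟪p z, H (p z)⟫ + ⟪q z, H (q z)⟫| ≤ Λ * ‖z‖ ^ 2 := by
  rw [hs.sq_norm_eq z, mul_add]
  exact (abs_add_le _ _).trans (add_le_add (abs_inner_le hΛ _) (abs_inner_le hΛ _))

theorem abs_inner_scaledBlock_sub_le (hs : IsBlockSplit p q) {H : E →L[ℝ] E} {Λ : ℝ}
    (hΛ : ∀ x, ‖H x‖ ≤ Λ * ‖x‖) {σ : ℝ} (hσ : 1 ≤ σ) (hσ' : σ ≤ 3 / 2) (b : ℝ) (z : E) :
    |⟪z, scaledBlock p q H σ b z⟫ - b * ‖z‖ ^ 2| ≤ 2 * Λ * ‖z‖ ^ 2 := by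
  rw [inner_scaledBlock_self hs]
  have h1 := abs_le.1 (abs_inner_le hΛ z)
  have h2 := abs_le.1 (abs_inner_blocks_le hs hΛ z)
  have : 0 ≤ Λ * ‖z‖ ^ 2 := (abs_nonneg _).trans (abs_inner_le hΛ z)
  rw [abs_le]
  constructor <;> nlinarith

theorem sq_norm_step_le_drop (hs : IsBlockSplit p q) {G : E →L[ℝ] E}
    (hG : ∀ x y, ⟪G x, y⟫ = ⟪x, G y⟫) {T : ℝ}
    (hTG : ∀ x, T * ⟪p x, G (p x)⟫ ≤ ‖p x‖ ^ 2) (z : E) :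
    ‖(z - T • p (G z)) - z‖ ^ 2 ≤
      T * (⟪z, G z⟫ - ⟪z - T • p (G z), G (z - T • p (G z))⟫) := by
  have e1 : ⟪z, G (p (G z))⟫ = ‖p (G z)‖ ^ 2 := by
    rw [← hG, ← hs.inner_left_self, real_inner_self_eq_norm_sq]
  have e2 : ⟪p (G z), G z⟫ = ‖p (G z)‖ ^ 2 := by
    rw [real_inner_comm, ← hs.inner_left_self, real_inner_self_eq_norm_sq]
  have : ‖(z - T • p (G z)) - z‖ ^ 2 = T ^ 2 * ‖p (G z)‖ ^ 2 := by
    rw [sub_sub_cancel_left, norm_neg, norm_smul, mul_pow, Real.norm_eq_abs, sq_abs]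
  rw [this]
  simp only [map_sub, map_smul, inner_sub_left, inner_sub_right, real_inner_smul_left,
    real_inner_smul_right, e1, e2]
  nlinarith [mul_le_mul_of_nonneg_left (hTG (G z)) (sq_nonneg T)]

/-- In rescaled coordinates the alternating step for `H`, divided by its growth factor `l = σ²`, is
an alternating step for `scaledBlock`. -/
theorem altStep_rescale (hs : IsBlockSplit p q) (H : E →L[ℝ] E) {η σ : ℝ} (hη : η ≠ 0)
    (hσ : σ ≠ 0) (z : E) :
    altStep p q H η (p z + σ • q z) =
      σ ^ 2 • (p (altStep p q (scaledBlock p q H σ ((σ ^ 2 - 1) / η)) (η / σ ^ 2) z) +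
        σ • q (altStep p q (scaledBlock p q H σ ((σ ^ 2 - 1) / η)) (η / σ ^ 2) z)) := by
  simp only [altStep_apply, scaledBlock_apply, map_add, map_sub, map_smul, hs.left_left,
    hs.left_right, hs.right_left, hs.right_right, map_zero, smul_zero, add_zero, zero_add,
    sub_zero, smul_add, smul_sub, smul_smul]
  match_scalars <;> field_simp <;> ring
end

section

variable {E : Type*} [NormedAddCommGroup E] [InnerProductSpace ℝ E] {p q : E →L[ℝ] E}

theorem sq_norm_altStep_le_drop (hs : IsBlockSplit p q) {G : E →L[ℝ] E}
    (hG : ∀ x y, ⟪G x, y⟫ = ⟪x, G y⟫) {T : ℝ}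
    (hTG : ∀ x, T * ⟪x, G x⟫ ≤ ‖x‖ ^ 2) (z : E) :
    ‖altStep p q G T z - z‖ ^ 2 ≤
      (2 * T) * (⟪z, G z⟫ - ⟪altStep p q G T z, G (altStep p q G T z)⟫) := by
  have h1 := sq_norm_step_le_drop hs hG (T := T) (fun x => hTG _) z
  have h2 := sq_norm_step_le_drop hs.symm hG (T := T) (fun x => hTG _) (z - T • p (G z))
  rw [altStep_apply]
  set z' := z - T • p (G z)
  set z'' := z' - T • q (G z')
  have : ‖z'' - z‖ ≤ ‖z'' - z'‖ + ‖z' - z‖ := norm_sub_le_norm_sub_add_norm_sub _ _ _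
  nlinarith [norm_nonneg (z'' - z), sq_nonneg (‖z'' - z'‖ - ‖z' - z‖)]

theorem norm_altStep_pow_le (hs : IsBlockSplit p q) {H : E →L[ℝ] E}
    (hH : ∀ x y, ⟪H x, y⟫ = ⟪x, H y⟫) {Λ η σ : ℝ} (hΛ : ∀ x, ‖H x‖ ≤ Λ * ‖x‖)
    (hΛ0 : 0 ≤ Λ) (hη : 0 < η) (hηΛ : η * Λ ≤ 1 / 4) (hσ : 1 ≤ σ) (hσ' : σ ≤ 3 / 2)
    (hσ2 : (σ ^ 2 - 1) / η ≤ 2 * Λ)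
    (hpos : ∀ z, 0 ≤ ⟪z, scaledBlock p q H σ ((σ ^ 2 - 1) / η) z⟫) (n : ℕ) (v : E) :
    ‖(altStep p q H η ^ n) v‖ ≤ 2 * (1 + √(8 * n * (η * Λ))) * (σ ^ 2) ^ n * ‖v‖ := by
  set b := (σ ^ 2 - 1) / η with hb
  set G := scaledBlock p q H σ b with hGdef
  set T := η / σ ^ 2 with hT
  have hσ0 : 0 < σ := by linarith
  have hbη : b * η = σ ^ 2 - 1 := by rw [hb]; field_simp
  have hT0 : 0 < T := by positivity
  have hTη : T ≤ η := div_le_self hη.le (by nlinarith)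
  have hG := inner_scaledBlock_comm hs hH σ b
  have hGle : ∀ z, ⟪z, G z⟫ ≤ 2 * Λ * ‖z‖ ^ 2 + b * ‖z‖ ^ 2 := fun z => by
    have := (abs_le.1 (abs_inner_scaledBlock_sub_le hs hΛ hσ hσ' b z)).2
    linarith
  have hTG : ∀ z, T * ⟪z, G z⟫ ≤ ‖z‖ ^ 2 := fun z => by
    have : T * (2 * Λ + b) ≤ 1 := by
      rw [hT, div_mul_eq_mul_div, div_le_one (by positivity)]
      nlinarith
    nlinarith [mul_le_mul_of_nonneg_left (hGle z) hT0.le, sq_nonneg ‖z‖]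
  set z₀ := p v + σ⁻¹ • q v with hz₀
  have hv : p z₀ + σ • q z₀ = v := by
    simp only [hz₀, map_add, map_smul, hs.left_left, hs.left_right, hs.right_left, hs.right_right,
      smul_zero, add_zero, zero_add, smul_smul, mul_inv_cancel₀ hσ0.ne', one_smul, hs.add_eq]
  have hz₀v : ‖z₀‖ ≤ ‖v‖ := by
    rw [← sq_le_sq₀ (norm_nonneg _) (norm_nonneg _), hz₀, ← map_smul, hs.sq_norm_comb,
      hs.sq_norm_eq v, map_smul, norm_smul, mul_pow]
    have : ‖σ⁻¹‖ ≤ 1 := by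
      rw [norm_inv, Real.norm_of_nonneg hσ0.le]; exact inv_le_one_of_one_le₀ hσ
    have : ‖σ⁻¹‖ ^ 2 ≤ 1 := pow_le_one₀ (norm_nonneg _) this
    nlinarith [sq_nonneg ‖q v‖]
  set z : ℕ → E := fun n => (altStep p q G T ^ n) z₀ with hz
  have hzs : ∀ n, z (n + 1) = altStep p q G T (z n) := fun n => by
    simp only [hz, pow_succ', mul_apply_eq_comp]
  have hpow : ∀ n, (altStep p q H η ^ n) v = (σ ^ 2) ^ n • (p (z n) + σ • q (z n)) := by
    intro n
    induction n with
    | zero => simp [hz, hv]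
    | succ n ih =>
      rw [pow_succ', mul_apply_eq_comp, ih, map_smul,
        altStep_rescale hs H hη.ne' hσ0.ne', hzs, smul_smul, ← pow_succ]
  have hdrop := sq_norm_sub_le_of_drop z (fun n => ⟪z n, G (z n)⟫) (B := 2 * T)
    (fun n => by
      have := sq_norm_altStep_le_drop hs hG hTG (z n)
      rwa [← hzs] at this) n
  have hz0 : z 0 = z₀ := by simp [hz]
  have h1 : ‖z n - z₀‖ ^ 2 ≤ (8 * n * (η * Λ)) * ‖z₀‖ ^ 2 := by
    rw [← hz0]
    refine hdrop.trans ?_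
    have h2 : ⟪z 0, G (z 0)⟫ ≤ 4 * Λ * ‖z 0‖ ^ 2 := by
      nlinarith [hGle (z 0), sq_nonneg ‖z 0‖]
    have h3 := hpos (z n)
    calc (n : ℝ) * (2 * T * (⟪z 0, G (z 0)⟫ - ⟪z n, G (z n)⟫))
        ≤ n * (2 * η * (4 * Λ * ‖z 0‖ ^ 2)) := by
          have : ⟪z 0, G (z 0)⟫ - ⟪z n, G (z n)⟫ ≤ 4 * Λ * ‖z 0‖ ^ 2 := by linarith
          have h4 : 0 ≤ 4 * Λ * ‖z 0‖ ^ 2 := by positivity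
          have : T * (⟪z 0, G (z 0)⟫ - ⟪z n, G (z n)⟫) ≤ η * (4 * Λ * ‖z 0‖ ^ 2) :=
            (mul_le_mul_of_nonneg_left this hT0.le).trans (mul_le_mul_of_nonneg_right hTη h4)
          exact mul_le_mul_of_nonneg_left (by linarith) (Nat.cast_nonneg n)
      _ = _ := by ring
  have h2 : ‖z n - z₀‖ ≤ √(8 * n * (η * Λ)) * ‖z₀‖ := by
    rw [← Real.sqrt_sq (norm_nonneg z₀), ← Real.sqrt_mul (by positivity)]
    exact Real.le_sqrt_of_sq_le h1
  have h3 : ‖z n‖ ≤ (1 + √(8 * n * (η * Λ))) * ‖z₀‖ := by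
    have := norm_add_le (z n - z₀) z₀
    rw [sub_add_cancel] at this
    linarith
  have h4 : ‖p (z n) + σ • q (z n)‖ ≤ 2 * ‖z n‖ := by
    rw [← sq_le_sq₀ (norm_nonneg _) (by positivity), ← map_smul, hs.sq_norm_comb, mul_pow,
      hs.sq_norm_eq (z n), map_smul, norm_smul, mul_pow, Real.norm_of_nonneg hσ0.le]
    have : σ ^ 2 ≤ 4 := by nlinarith
    nlinarith [sq_nonneg ‖q (z n)‖, sq_nonneg ‖p (z n)‖]
  rw [hpow, norm_smul, Real.norm_of_nonneg (by positivity)]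
  calc (σ ^ 2) ^ n * ‖p (z n) + σ • q (z n)‖
      ≤ (σ ^ 2) ^ n * (2 * ((1 + √(8 * n * (η * Λ))) * ‖v‖)) := by
        gcongr
        exact h4.trans (by gcongr; exact h3.trans (by gcongr))
    _ = _ := by ring

/-- A vector in the kernel of `scaledBlock` gives a left eigenvector of the alternating step. -/
theorem inner_altStep_of_kernel (hs : IsBlockSplit p q) {H : E →L[ℝ] E}
    (hH : ∀ x y, ⟪H x, y⟫ = ⟪x, H y⟫) {η σ : ℝ} (hη : η ≠ 0) {x : E}
    (hx : scaledBlock p q H σ ((σ ^ 2 - 1) / η) x = 0) (v : E) :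
    ⟪(σ / η) • (σ • p x + q x) + σ • p (H (q x)), altStep p q H η v⟫ =
      σ ^ 2 * ⟪(σ / η) • (σ • p x + q x) + σ • p (H (q x)), v⟫ := by
  obtain ⟨a, b, rfl⟩ : ∃ a b, v = p a + q b := ⟨v, v, (hs.add_eq v).symm⟩
  rw [scaledBlock_apply] at hx
  have hp : ⟪p (H (p x)) + σ • p (H (q x)) + ((σ ^ 2 - 1) / η) • p x, p a + q b⟫ = 0 := by
    have := congrArg p hx
    simp only [map_add, map_smul, hs.left_left, hs.left_right, add_zero, smul_add, smul_zero,
      map_zero] at this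
    rw [this, inner_zero_left]
  have hq : ⟪q (H (q x)) + σ • q (H (p x)) + ((σ ^ 2 - 1) / η) • q x, p a + q b⟫ = 0 := by
    have := congrArg q hx
    simp only [map_add, map_smul, hs.right_left, hs.right_right, zero_add, smul_add, smul_zero,
      map_zero] at this
    rw [this, inner_zero_left]
  simp only [altStep_apply, inner_add_left, inner_add_right, inner_sub_right, real_inner_smul_left,
    real_inner_smul_right, map_add, map_sub, map_smul, hs.inner_left, hs.inner_right, hH,
    hs.left_left, hs.left_right, hs.right_left, hs.right_right, inner_zero_right, map_zero,
    sub_zero, add_zero, zero_add, mul_zero] at hp hq ⊢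
  linear_combination (norm := (field_simp; ring)) -σ ^ 2 * hp - σ * hq
end

section

variable {E : Type*} [NormedAddCommGroup E] [InnerProductSpace ℝ E] {p q : E →L[ℝ] E}

theorem eq_zero_of_nonneg_of_inner_eq_zero {G : E →L[ℝ] E} (hG : ∀ x y, ⟪G x, y⟫ = ⟪x, G y⟫)
    (hpos : ∀ z, 0 ≤ ⟪z, G z⟫) {x : E} (hx : ⟪x, G x⟫ ≤ 0) : G x = 0 := by
  by_contra hne
  have h0 : 0 < ‖G x‖ ^ 2 := by positivity
  have key : ∀ t : ℝ, 0 ≤ 2 * t * ‖G x‖ ^ 2 + t ^ 2 * ⟪G x, G (G x)⟫ := fun t => by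
    have h1 := hpos (x + t • G x)
    have h2 : ⟪x, G (G x)⟫ = ‖G x‖ ^ 2 := by rw [← hG, real_inner_self_eq_norm_sq]
    simp only [map_add, map_smul, inner_add_left, inner_add_right, real_inner_smul_left,
      real_inner_smul_right, h2, real_inner_self_eq_norm_sq] at h1
    linarith
  have h1 := hpos (G x)
  set A := ‖G x‖ ^ 2
  set B := ⟪G x, G (G x)⟫
  have := key (-(A / (B + 1)))
  have h3 : 2 * -(A / (B + 1)) * A + (-(A / (B + 1))) ^ 2 * B =
      -(A ^ 2 * (B + 2) / (B + 1) ^ 2) := by field_simp; ring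
  rw [h3] at this
  have : 0 < A ^ 2 * (B + 2) / (B + 1) ^ 2 := by positivity
  linarith

theorem exists_growth_factor [FiniteDimensional ℝ E] (hs : IsBlockSplit p q) {H : E →L[ℝ] E}
    (hH : ∀ x y, ⟪H x, y⟫ = ⟪x, H y⟫) {Λ η γ : ℝ} (hΛ : ∀ x, ‖H x‖ ≤ Λ * ‖x‖)
    (hη : 0 < η) (hηΛ : η * Λ ≤ 1 / 4) (hγ : 0 < γ) {v : E} (hv : ‖v‖ = 1)
    (hvH : ⟪v, H v⟫ ≤ -γ) :
    ∃ σ : ℝ, 1 + η * γ / 2 ≤ σ ^ 2 ∧ 1 ≤ σ ∧ σ ≤ 3 / 2 ∧ (σ ^ 2 - 1) / η ≤ 2 * Λ ∧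
      (∀ z, 0 ≤ ⟪z, scaledBlock p q H σ ((σ ^ 2 - 1) / η) z⟫) ∧
      ∃ x, x ≠ 0 ∧ scaledBlock p q H σ ((σ ^ 2 - 1) / η) x = 0 := by
  have hγΛ : γ ≤ Λ := by
    have := (abs_le.1 (abs_inner_le hΛ v)).1
    rw [hv] at this; linarith
  let g : ℝ × E → ℝ := fun a => ⟪a.2, scaledBlock p q H (√(1 + a.1)) (a.1 / η) a.2⟫
  have hg : Continuous g := by
    simp only [g, inner_scaledBlock_self hs]
    fun_prop
  have hsq : ∀ μ : ℝ, 0 ≤ μ → 1 ≤ √(1 + μ) := fun μ h => Real.one_le_sqrt.2 (by linarith)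
  have hsq' : ∀ μ : ℝ, 0 ≤ μ → √(1 + μ) ≤ 1 + μ / 2 := fun μ h =>
    Real.sqrt_le_iff.2 ⟨by linarith, by nlinarith⟩
  have hcomp : IsCompact ((Set.Icc (0 : ℝ) 1 ×ˢ Metric.sphere (0 : E) 1) ∩ {a | g a ≤ 0}) :=
    (isCompact_Icc.prod (isCompact_sphere 0 1)).inter_right (isClosed_le hg continuous_const)
  have hμ₀ : η * γ / 2 ≤ 1 := by nlinarith
  have hmem : (η * γ / 2, v) ∈
      (Set.Icc (0 : ℝ) 1 ×ˢ Metric.sphere (0 : E) 1) ∩ {a | g a ≤ 0} := by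
    refine ⟨⟨⟨by positivity, hμ₀⟩, by simpa using hv⟩, ?_⟩
    simp only [Set.mem_ofPred_eq, g, inner_scaledBlock_self hs, hv]
    have h1 := hsq (η * γ / 2) (by positivity)
    have h2 := hsq' (η * γ / 2) (by positivity)
    have h3 := (abs_le.1 (abs_inner_blocks_le hs hΛ v)).1
    rw [hv] at h3
    have h4 : η * γ / 2 / η = γ / 2 := by field_simp
    rw [h4]
    nlinarith
  obtain ⟨⟨μ, x⟩, ⟨⟨⟨hμ0, hμ1⟩, hx⟩, hgx⟩, hmax⟩ :=
    hcomp.exists_isMaxOn ⟨_, hmem⟩ continuous_fst.continuousOn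
  simp only [Set.mem_ofPred_eq] at hgx hμ0 hμ1
  have hx1 : ‖x‖ = 1 := by simpa using hx
  have hμγ : η * γ / 2 ≤ μ := hmax hmem
  have hσ2 : √(1 + μ) ^ 2 = 1 + μ := Real.sq_sqrt (by linarith)
  have hσ1 := hsq μ hμ0
  have hσ' : √(1 + μ) ≤ 3 / 2 := (hsq' μ hμ0).trans (by linarith)
  have hb : (√(1 + μ) ^ 2 - 1) / η = μ / η := by rw [hσ2]; ring
  have hμΛ : μ / η ≤ 2 * Λ := by
    have := (abs_le.1 (abs_inner_scaledBlock_sub_le hs hΛ hσ1 hσ' (μ / η) x)).1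
    simp only [hx1, g] at this hgx
    linarith
  have hμ1' : μ < 1 := by
    rw [div_le_iff₀ hη] at hμΛ; nlinarith
  have hpos1 : ∀ z : E, ‖z‖ = 1 → 0 ≤ g (μ, z) := fun z hz => by
    have ht : Filter.Tendsto (fun ν => g (ν, z)) (nhdsWithin μ (Set.Ioi μ)) (nhds (g (μ, z))) :=
      ((hg.comp (by fun_prop : Continuous fun ν : ℝ => (ν, z))).tendsto μ).mono_left
        nhdsWithin_le_nhds
    refine ge_of_tendsto ht ?_
    filter_upwards [Ioo_mem_nhdsGT hμ1'] with ν hν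
    by_contra! hlt
    have : ν ≤ μ := hmax (a := (ν, z))
      ⟨⟨⟨hμ0.trans hν.1.le, hν.2.le⟩, by simpa using hz⟩, hlt.le⟩
    exact absurd hν.1 (not_lt.2 this)
  have hpos : ∀ z : E, 0 ≤ ⟪z, scaledBlock p q H (√(1 + μ)) (μ / η) z⟫ := fun z => by
    rcases eq_or_ne z 0 with rfl | hz
    · simp
    have h1 := hpos1 (‖z‖⁻¹ • z) (by
      rw [norm_smul, norm_inv, norm_norm, inv_mul_cancel₀ (norm_ne_zero_iff.2 hz)])
    simp only [g, map_smul, real_inner_smul_left, real_inner_smul_right] at h1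
    have h2 : 0 < ‖z‖⁻¹ := by positivity
    exact nonneg_of_mul_nonneg_right (nonneg_of_mul_nonneg_right h1 h2) h2
  refine ⟨√(1 + μ), by rw [hσ2]; linarith, hσ1, hσ', by rw [hb]; exact hμΛ, ?_, x, ?_, ?_⟩
  · rw [hb]; exact hpos
  · rintro rfl; simp at hx1
  · rw [hb]
    exact eq_zero_of_nonneg_of_inner_eq_zero (inner_scaledBlock_comm hs hH _ _) hpos hgx

theorem exists_left_eigenvector [FiniteDimensional ℝ E] (hs : IsBlockSplit p q) {H : E →L[ℝ] E}
    (hH : ∀ x y, ⟪H x, y⟫ = ⟪x, H y⟫) {Λ η γ : ℝ} (hΛ : ∀ x, ‖H x‖ ≤ Λ * ‖x‖)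
    (hη : 0 < η) (hηΛ : η * Λ ≤ 1 / 4) (hγ : 0 < γ) {v : E} (hv : ‖v‖ = 1)
    (hvH : ⟪v, H v⟫ ≤ -γ) :
    ∃ l : ℝ, 1 + η * γ / 2 ≤ l ∧
      (∃ φ : E, ‖φ‖ = 1 ∧ ∀ w, ⟪φ, altStep p q H η w⟫ = l * ⟪φ, w⟫) ∧
      ∀ (n : ℕ) (w : E),
        ‖(altStep p q H η ^ n) w‖ ≤ 2 * (1 + √(8 * n * (η * Λ))) * l ^ n * ‖w‖ := by
  have hΛ0 : 0 ≤ Λ := by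
    have := (norm_nonneg _).trans (hΛ v)
    rwa [hv, mul_one] at this
  obtain ⟨σ, hl, hσ, hσ', hσ2, hpos, x, hx0, hx⟩ :=
    exists_growth_factor hs hH hΛ hη hηΛ hγ hv hvH
  refine ⟨σ ^ 2, hl, ?_, norm_altStep_pow_le hs hH hΛ hΛ0 hη hηΛ hσ hσ' hσ2 hpos⟩
  set φ := (σ / η) • (σ • p x + q x) + σ • p (H (q x)) with hφ
  have hev := inner_altStep_of_kernel hs hH hη.ne' hx
  rw [← hφ] at hev
  have hσ0 : 0 < σ := by linarith
  have hφ0 : φ ≠ 0 := by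
    intro h0
    have hq : q x = 0 := by
      have := congrArg q (hφ.symm.trans h0)
      simp only [map_add, map_smul, hs.right_left, hs.right_right, smul_zero, zero_add, add_zero,
        map_zero] at this
      exact (smul_eq_zero.1 this).resolve_left (by positivity)
    rw [hφ, hq] at h0
    simp only [map_zero, smul_zero, add_zero, smul_smul] at h0
    have hp := (smul_eq_zero.1 h0).resolve_left (by positivity)
    exact hx0 (by rw [← hs.add_eq x, hp, hq, add_zero])
  refine ⟨‖φ‖⁻¹ • φ, ?_, fun w => ?_⟩
  · rw [norm_smul, norm_inv, norm_norm, inv_mul_cancel₀ (norm_ne_zero_iff.2 hφ0)]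
  · rw [real_inner_smul_left, real_inner_smul_left, hev]; ring

/-- Exponential separation of two nearly linear trajectories. -/
theorem le_norm_of_perturbed {A : E →L[ℝ] E} {l C κ s : ℝ} (hl : 1 ≤ l)
    (hC : 1 ≤ C) (hκ : 0 ≤ κ) (hs : 0 ≤ s) {φ : E} (hφ : ‖φ‖ = 1)
    (hφA : ∀ w, ⟪φ, A w⟫ = l * ⟪φ, w⟫) {K : ℕ}
    (hA : ∀ n ≤ K, ∀ w, ‖(A ^ n) w‖ ≤ C * l ^ n * ‖w‖) {v : ℕ → E} (hv0 : v 0 = s • φ)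
    (hv : ∀ n < K, ‖v (n + 1) - A (v n)‖ ≤ κ * ‖v n‖) (hκC : 2 * C * κ * K ≤ 1 / 2) :
    l ^ K * s / 2 ≤ ‖v K‖ := by
  have hl0 : 0 < l := by linarith
  set e : ℕ → E := fun n => v (n + 1) - A (v n) with he
  have hsol : ∀ n, v n = (A ^ n) (v 0) + ∑ j ∈ Finset.range n, (A ^ (n - 1 - j)) (e j) := by
    intro n
    induction n with
    | zero => simp
    | succ n ih =>
      have h1 : v (n + 1) = A (v n) + e n := by simp [he]
      rw [h1, Finset.sum_range_succ]
      conv_lhs => rw [ih]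
      have h2 : ∀ j ∈ Finset.range n,
          (A ^ (n + 1 - 1 - j)) (e j) = A ((A ^ (n - 1 - j)) (e j)) := fun j hj => by
        have : n + 1 - 1 - j = (n - 1 - j) + 1 := by
          have := Finset.mem_range.1 hj; omega
        rw [this, pow_succ', mul_apply_eq_comp]
      rw [Finset.sum_congr rfl h2, map_add, map_sum, pow_succ', mul_apply_eq_comp]
      simp [add_assoc]
  have hn0 : ‖v 0‖ = s := by rw [hv0, norm_smul, hφ, mul_one, Real.norm_of_nonneg hs]
  have hbound : ∀ n ≤ K, ‖v n‖ ≤ 2 * C * l ^ n * s := by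
    intro n
    induction n using Nat.strong_induction_on with
    | _ n ih =>
      intro hn
      rw [hsol n]
      have h1 : ∀ j ∈ Finset.range n,
          ‖(A ^ (n - 1 - j)) (e j)‖ ≤ C * (2 * C * κ) * l ^ n * s := fun j hj => by
        have hj := Finset.mem_range.1 hj
        have h2 : ‖e j‖ ≤ κ * (2 * C * l ^ j * s) :=
          (hv j (by omega)).trans (mul_le_mul_of_nonneg_left (ih j hj (by omega)) hκ)
        calc _ ≤ C * l ^ (n - 1 - j) * (κ * (2 * C * l ^ j * s)) :=
              (hA _ (by omega) _).trans (by gcongr)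
          _ = C * (2 * C * κ) * l ^ (n - 1) * s := by
              rw [show n - 1 = (n - 1 - j) + j by omega, pow_add]
              simp only [Nat.add_sub_cancel]; ring
          _ ≤ _ := by gcongr; omega
      calc _ ≤ ‖(A ^ n) (v 0)‖ + ∑ j ∈ Finset.range n, ‖(A ^ (n - 1 - j)) (e j)‖ :=
            (norm_add_le _ _).trans (add_le_add_right (norm_sum_le _ _) _)
        _ ≤ C * l ^ n * s + n * (C * (2 * C * κ) * l ^ n * s) := by
            refine add_le_add ((hA n hn _).trans_eq (by rw [hn0])) ?_
            simpa using Finset.sum_le_sum h1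
        _ = C * l ^ n * s * (1 + 2 * C * κ * n) := by ring
        _ ≤ C * l ^ n * s * (1 + 1) := by
            have : 2 * C * κ * n ≤ 2 * C * κ * K := by gcongr
            gcongr; linarith
        _ = _ := by ring
  have hφpow : ∀ n w, ⟪φ, (A ^ n) w⟫ = l ^ n * ⟪φ, w⟫ := by
    intro n
    induction n with
    | zero => simp
    | succ n ih => intro w; rw [pow_succ', mul_apply_eq_comp, hφA, ih]; ring
  have h1 : ⟪φ, v K⟫ = l ^ K * s + ∑ j ∈ Finset.range K, l ^ (K - 1 - j) * ⟪φ, e j⟫ := by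
    conv_lhs => rw [hsol K]
    rw [inner_add_right, inner_sum, hφpow, hv0, real_inner_smul_right, real_inner_self_eq_norm_sq,
      hφ]
    simp only [hφpow]; ring
  have h2 : ∀ j ∈ Finset.range K, -(2 * C * κ * l ^ K * s) ≤ l ^ (K - 1 - j) * ⟪φ, e j⟫ :=
    fun j hj => by
      have hj := Finset.mem_range.1 hj
      have h3 : |⟪φ, e j⟫| ≤ κ * (2 * C * l ^ j * s) := by
        refine (abs_real_inner_le_norm _ _).trans ?_
        rw [hφ, one_mul]
        exact (hv j hj).trans (mul_le_mul_of_nonneg_left (hbound j hj.le) hκ)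
      have h4 : l ^ (K - 1 - j) * (κ * (2 * C * l ^ j * s)) ≤ 2 * C * κ * l ^ K * s := by
        calc _ = 2 * C * κ * l ^ (K - 1) * s := by
              rw [show K - 1 = (K - 1 - j) + j by omega, pow_add]
              simp only [Nat.add_sub_cancel]; ring
          _ ≤ _ := by gcongr; omega
      have h5 := mul_le_mul_of_nonneg_left (abs_le.1 h3).1 (pow_nonneg hl0.le (K - 1 - j))
      linarith
  have h3 := Finset.sum_le_sum h2
  rw [Finset.sum_const, Finset.card_range, nsmul_eq_mul] at h3
  have h4 : ⟪φ, v K⟫ ≤ ‖v K‖ := by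
    simpa [hφ] using real_inner_le_norm φ (v K)
  have h5 : (2 * C * κ * K) * (l ^ K * s) ≤ 1 / 2 * (l ^ K * s) := by gcongr
  linarith
end

section

variable {d : ℕ} {blk : Fin d → Fin 2} {f : EuclideanSpace ℝ (Fin d) → ℝ}

/-- `blockPart` as a continuous linear map. -/
noncomputable def blockProj (blk : Fin d → Fin 2) (k : Fin 2) :
    EuclideanSpace ℝ (Fin d) →L[ℝ] EuclideanSpace ℝ (Fin d) :=
  LinearMap.toContinuousLinearMap
    { toFun := blockPart blk k
      map_add' := fun x y => by
        ext i; simp only [blockPart, PiLp.add_apply]; split_ifs <;> simp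
      map_smul' := fun a x => by
        ext i; simp only [blockPart, PiLp.smul_apply, RingHom.id_apply]; split_ifs <;> simp }

theorem blockProj_apply (k : Fin 2) (x : EuclideanSpace ℝ (Fin d)) (i : Fin d) :
    blockProj blk k x i = if blk i = k then x i else 0 := rfl

theorem blockGrad_eq (k : Fin 2) (x : EuclideanSpace ℝ (Fin d)) :
    blockGrad blk f k x = blockProj blk k (gradient f x) := rfl

theorem inner_blockProj (k : Fin 2) (x y : EuclideanSpace ℝ (Fin d)) :
    ⟪blockProj blk k x, y⟫ = ⟪x, blockProj blk k y⟫ := by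
  simp only [PiLp.inner_apply, blockProj_apply]
  refine Finset.sum_congr rfl fun i _ => ?_
  split_ifs <;> simp

theorem blockProj_blockProj (j k : Fin 2) (x : EuclideanSpace ℝ (Fin d)) :
    blockProj blk j (blockProj blk k x) = if j = k then blockProj blk k x else 0 := by
  ext i
  rw [blockProj_apply, blockProj_apply]
  by_cases h : j = k <;> simp [h, blockProj_apply] <;> grind

theorem isBlockSplit_blockProj (blk : Fin d → Fin 2) :
    IsBlockSplit (blockProj blk 0) (blockProj blk 1) where
  inner_left := inner_blockProj 0
  inner_right := inner_blockProj 1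
  left_left x := by simp [blockProj_blockProj]
  left_right x := by simp [blockProj_blockProj]
  right_left x := by simp [blockProj_blockProj]
  right_right x := by simp [blockProj_blockProj]
  add_eq x := by
    ext i
    simp only [PiLp.add_apply, blockProj_apply]
    have : blk i = 0 ∨ blk i = 1 := by omega
    rcases this with h | h <;> simp [h]

theorem norm_blockProj_le (k : Fin 2) (x : EuclideanSpace ℝ (Fin d)) :
    ‖blockProj blk k x‖ ≤ ‖x‖ := by
  have : k = 0 ∨ k = 1 := by omega
  rcases this with rfl | rfl
  · exact (isBlockSplit_blockProj blk).norm_left_le x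
  · exact (isBlockSplit_blockProj blk).norm_right_le x

theorem le_blockLmax (Lb Lt : Fin 2 → ℝ) (k : Fin 2) :
    Lb k ≤ blockLmax Lb Lt ∧ Lt k ≤ blockLmax Lb Lt := by
  have : k = 0 ∨ k = 1 := by omega
  rcases this with rfl | rfl <;> simp [blockLmax]

variable {Lb Lt : Fin 2 → ℝ}

theorem IsBlockSmooth.norm_gradient_sub_le (h : IsBlockSmooth blk f Lb Lt)
    (hM : 0 ≤ blockLmax Lb Lt) (x y : EuclideanSpace ℝ (Fin d)) :
    ‖gradient f x - gradient f y‖ ≤ 4 * blockLmax Lb Lt * ‖x - y‖ := by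
  have hs := isBlockSplit_blockProj blk
  have hk : ∀ (k : Fin 2), ‖blockProj blk k (gradient f x - gradient f y)‖ ≤
      2 * blockLmax Lb Lt * ‖x - y‖ := fun k => by
    have hm : ∃ m, (∀ i, blk i ≠ k → x i = m i) ∧ (∀ i, blk i = k → m i = y i) ∧
        ‖x - m‖ ≤ ‖x - y‖ ∧ ‖m - y‖ ≤ ‖x - y‖ := by
      refine ⟨x - blockProj blk k (x - y), fun i hi => ?_, fun i hi => ?_, ?_, ?_⟩
      · simp [blockProj_apply, hi]
      · simp [blockProj_apply, hi]
      · rw [sub_sub_cancel]; exact norm_blockProj_le _ _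
      · rw [sub_right_comm]
        have : k = 0 ∨ k = 1 := by omega
        rcases this with rfl | rfl
        · rw [show x - y - blockProj blk 0 (x - y) = blockProj blk 1 (x - y) from
            sub_eq_of_eq_add' (hs.add_eq _).symm]
          exact norm_blockProj_le _ _
        · rw [show x - y - blockProj blk 1 (x - y) = blockProj blk 0 (x - y) from
            sub_eq_of_eq_add (hs.add_eq _).symm]
          exact norm_blockProj_le _ _
    obtain ⟨m, hm1, hm2, hm3, hm4⟩ := hm
    have h1 := h.2.1 k x m hm1
    have h2 := h.2.2 k m y hm2
    have h3 : ‖blockProj blk k (gradient f x - gradient f y)‖ ≤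
        ‖blockGrad blk f k x - blockGrad blk f k m‖ +
          ‖blockGrad blk f k m - blockGrad blk f k y‖ := by
      rw [map_sub]; exact norm_sub_le_norm_sub_add_norm_sub _ _ _
    have h4 : Lb k * ‖x - m‖ ≤ blockLmax Lb Lt * ‖x - y‖ := by
      gcongr; exact (le_blockLmax Lb Lt k).1
    have h5 : Lt k * ‖m - y‖ ≤ blockLmax Lb Lt * ‖x - y‖ := by
      gcongr; exact (le_blockLmax Lb Lt k).2
    linarith
  calc _ = ‖blockProj blk 0 (gradient f x - gradient f y) +
      blockProj blk 1 (gradient f x - gradient f y)‖ := by rw [hs.add_eq]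
    _ ≤ _ := norm_add_le _ _
    _ ≤ _ := add_le_add (hk 0) (hk 1)
    _ = _ := by ring

theorem hasDerivAt_line (hf : Differentiable ℝ f) (x v : EuclideanSpace ℝ (Fin d)) (s : ℝ) :
    HasDerivAt (fun s : ℝ => f (x + s • v)) ⟪gradient f (x + s • v), v⟫ s := by
  have h1 := (hf (x + s • v)).hasGradientAt.hasFDerivAt
  have h2 : HasDerivAt (fun s : ℝ => x + s • v) v s := by
    simpa using ((hasDerivAt_id s).smul_const v).const_add x
  exact h1.comp_hasDerivAt s h2

theorem IsBlockSmooth.le_sub_of_block_step (h : IsBlockSmooth blk f Lb Lt) {η : ℝ} (hη : 0 ≤ η)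
    (hηL : η * blockLmax Lb Lt ≤ 1 / 2) (k : Fin 2) (x : EuclideanSpace ℝ (Fin d)) :
    f (x - η • blockGrad blk f k x) ≤ f x - η / 2 * ‖blockGrad blk f k x‖ ^ 2 := by
  set g := blockGrad blk f k x with hg
  have hd := hasDerivAt_line h.1 x (-(η • g))
  have hanti : AntitoneOn (fun s : ℝ => f (x + s • -(η • g)) + s * (η / 2 * ‖g‖ ^ 2))
      (Set.Icc 0 1) := by
    have hd' : ∀ s : ℝ, HasDerivAt
        (fun s : ℝ => f (x + s • -(η • g)) + s * (η / 2 * ‖g‖ ^ 2))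
        (⟪gradient f (x + s • -(η • g)), -(η • g)⟫ + 1 * (η / 2 * ‖g‖ ^ 2)) s := fun s =>
      (hd s).add ((hasDerivAt_id s).mul_const _)
    refine antitoneOn_of_deriv_nonpos (convex_Icc 0 1)
      (fun s _ => (hd' s).continuousAt.continuousWithinAt)
      (fun s _ => (hd' s).differentiableAt.differentiableWithinAt) fun s hs => ?_
    rw [interior_Icc] at hs
    rw [(hd' s).deriv, inner_neg_right, real_inner_smul_right]
    set y := x + s • -(η • g) with hy
    have e1 : ⟪gradient f y, g⟫ = ⟪blockGrad blk f k y, g⟫ := by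
      rw [hg, blockGrad_eq, blockGrad_eq, inner_blockProj, blockProj_blockProj, if_pos rfl]
    have e2 : ‖blockGrad blk f k y - g‖ ≤ blockLmax Lb Lt * (s * (η * ‖g‖)) := by
      have h1 := h.2.1 k y x fun i hi => by
        rw [hy, hg, blockGrad_eq]
        simp [blockProj_apply, hi]
      have h2 : ‖y - x‖ = s * (η * ‖g‖) := by
        rw [hy, add_sub_cancel_left, norm_smul, norm_neg, norm_smul, Real.norm_of_nonneg hη,
          Real.norm_of_nonneg hs.1.le]
      rw [h2] at h1
      refine h1.trans ?_
      have := hs.1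
      gcongr
      exact (le_blockLmax Lb Lt k).1
    have e3 : ‖g‖ ^ 2 - 1 / 2 * ‖g‖ ^ 2 ≤ ⟪blockGrad blk f k y, g⟫ := by
      have h1 : ⟪blockGrad blk f k y, g⟫ = ‖g‖ ^ 2 + ⟪blockGrad blk f k y - g, g⟫ := by
        rw [inner_sub_left, real_inner_self_eq_norm_sq]; ring
      have h2 := (abs_le.1 (abs_real_inner_le_norm (blockGrad blk f k y - g) g)).1
      have h3 : blockLmax Lb Lt * (s * (η * ‖g‖)) * ‖g‖ ≤ 1 / 2 * ‖g‖ ^ 2 := by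
        have : s * (η * blockLmax Lb Lt) ≤ 1 / 2 := by nlinarith [hs.1, hs.2]
        nlinarith [sq_nonneg ‖g‖]
      have h4 := mul_le_mul_of_nonneg_right e2 (norm_nonneg g)
      linarith
    rw [e1]
    nlinarith
  have := hanti (Set.left_mem_Icc.2 zero_le_one) (Set.right_mem_Icc.2 zero_le_one) zero_le_one
  simp only [one_smul, zero_smul, add_zero, zero_mul, one_mul, ← sub_eq_add_neg] at this
  linarith

theorem agdStep_sub (η : ℝ) (x : EuclideanSpace ℝ (Fin d)) :
    agdStep blk f η x - x = -(η • (blockProj blk 0 (gradient f x) +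
      blockProj blk 1 (gradient f (agdHalf blk f η x)))) := by
  rw [agdStep, blockGrad_eq]
  conv_lhs => enter [1, 1]; rw [agdHalf]
  rw [blockGrad_eq, smul_add]
  abel

theorem sq_norm_agdStep_sub (η : ℝ) (x : EuclideanSpace ℝ (Fin d)) :
    ‖agdStep blk f η x - x‖ ^ 2 = η ^ 2 * agdGradSq blk f η x := by
  rw [agdStep_sub, norm_neg, norm_smul, mul_pow, (isBlockSplit_blockProj blk).sq_norm_comb,
    Real.norm_eq_abs, sq_abs]
  rfl

theorem norm_agdHalf_sub_le (η : ℝ) (x : EuclideanSpace ℝ (Fin d)) :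
    ‖agdHalf blk f η x - x‖ ≤ ‖agdStep blk f η x - x‖ := by
  rw [← sq_le_sq₀ (norm_nonneg _) (norm_nonneg _), sq_norm_agdStep_sub, agdHalf,
    sub_sub_cancel_left, norm_neg, norm_smul, mul_pow, Real.norm_eq_abs, sq_abs, agdGradSq]
  nlinarith [sq_nonneg η, sq_nonneg ‖blockGrad blk f 1 (agdHalf blk f η x)‖]

theorem IsBlockSmooth.agdStep_le (h : IsBlockSmooth blk f Lb Lt) {η : ℝ} (hη : 0 ≤ η)
    (hηL : η * blockLmax Lb Lt ≤ 1 / 2) (x : EuclideanSpace ℝ (Fin d)) :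
    f (agdStep blk f η x) ≤ f x - η / 2 * agdGradSq blk f η x := by
  have h1 := h.le_sub_of_block_step hη hηL 0 x
  have h2 := h.le_sub_of_block_step hη hηL 1 (agdHalf blk f η x)
  rw [agdGradSq, agdStep, mul_add]
  rw [← agdHalf] at h1
  linarith

theorem IsBlockSmooth.norm_gradient_le (h : IsBlockSmooth blk f Lb Lt) {η : ℝ} (hη : 0 ≤ η)
    (hηL : η * blockLmax Lb Lt ≤ 1 / 2) {g : ℝ} (hg : 0 ≤ g) {x : EuclideanSpace ℝ (Fin d)}
    (hx : agdGradSq blk f η x ≤ g ^ 2) : ‖gradient f x‖ ≤ 2 * g := by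
  rw [agdGradSq] at hx
  have h1 := h.2.2 1 (agdHalf blk f η x) x fun i hi => by
    rw [agdHalf, blockGrad_eq]; simp [blockProj_apply, hi]
  rw [agdHalf, sub_sub_cancel_left, norm_neg, norm_smul, Real.norm_of_nonneg hη, ← agdHalf] at h1
  set a := ‖blockGrad blk f 0 x‖ with ha
  set b := ‖blockGrad blk f 1 (agdHalf blk f η x)‖ with hb
  have h2 : ‖blockGrad blk f 1 x‖ ≤ b + 1 / 2 * a := by
    have h3 : ‖blockGrad blk f 1 x‖ ≤
        b + ‖blockGrad blk f 1 (agdHalf blk f η x) - blockGrad blk f 1 x‖ := by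
      rw [hb, norm_sub_rev]
      have := norm_add_le (blockGrad blk f 1 (agdHalf blk f η x))
        (blockGrad blk f 1 x - blockGrad blk f 1 (agdHalf blk f η x))
      rwa [add_sub_cancel] at this
    have h4 : Lt 1 * (η * a) ≤ 1 / 2 * a := by
      have : Lt 1 * (η * a) ≤ blockLmax Lb Lt * (η * a) := by
        gcongr; exact (le_blockLmax Lb Lt 1).2
      nlinarith [norm_nonneg (blockGrad blk f 0 x)]
    linarith
  have h5 : ‖gradient f x‖ ^ 2 = a ^ 2 + ‖blockGrad blk f 1 x‖ ^ 2 :=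
    (isBlockSplit_blockProj blk).sq_norm_eq _
  rw [← sq_le_sq₀ (norm_nonneg _) (by positivity), h5]
  have h6 : ‖blockGrad blk f 1 x‖ ^ 2 ≤ (b + 1 / 2 * a) ^ 2 :=
    pow_le_pow_left₀ (norm_nonneg _) h2 2
  nlinarith [sq_nonneg (a - b), sq_nonneg (a - 2 * b)]

theorem IsHessianLipschitz.inner_hessian_comm {ρ : ℝ} (h : IsHessianLipschitz f ρ)
    (x v w : EuclideanSpace ℝ (Fin d)) : ⟪hessian f x v, w⟫ = ⟪v, hessian f x w⟫ := by
  let D : EuclideanSpace ℝ (Fin d) →L[ℝ] (EuclideanSpace ℝ (Fin d) →L[ℝ] ℝ) :=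
    LinearMap.toContinuousLinearMap
      { toFun := fun y => InnerProductSpace.toDual ℝ _ y
        map_add' := fun y z => map_add _ y z
        map_smul' := fun a y => by simp }
  have h1 : HasFDerivAt (fun y => InnerProductSpace.toDual ℝ _ (gradient f y))
      (D.comp (hessian f x)) x := D.hasFDerivAt.comp x (h.2.1 x).hasFDerivAt
  have := second_derivative_symmetric (fun y => (h.1 y).hasGradientAt.hasFDerivAt) h1 v w
  rw [real_inner_comm _ v]
  exact this

theorem norm_hessian_apply_le {Λ : ℝ} (hΛ : 0 ≤ Λ)
    (h : ∀ x y, ‖gradient f x - gradient f y‖ ≤ Λ * ‖x - y‖)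
    (x v : EuclideanSpace ℝ (Fin d)) : ‖hessian f x v‖ ≤ Λ * ‖v‖ := by
  have : LipschitzWith (Real.toNNReal Λ) (gradient f) :=
    LipschitzWith.of_dist_le_mul fun a b => by
      rw [dist_eq_norm, dist_eq_norm, Real.coe_toNNReal _ hΛ]; exact h a b
  have h1 := norm_fderiv_le_of_lipschitz ℝ this (x₀ := x)
  rw [Real.coe_toNNReal _ hΛ] at h1
  exact ContinuousLinearMap.le_of_opNorm_le _ h1 v

theorem IsHessianLipschitz.norm_gradient_sub_sub_le {ρ : ℝ} (h : IsHessianLipschitz f ρ)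
    (hρ : 0 ≤ ρ) {S : ℝ} {x u w : EuclideanSpace ℝ (Fin d)} (hu : ‖u - x‖ ≤ S) (hw : ‖w - x‖ ≤ S) :
    ‖gradient f w - gradient f u - hessian f x (w - u)‖ ≤ ρ * S * ‖w - u‖ := by
  have hd : ∀ y ∈ Metric.closedBall x S, HasFDerivWithinAt (fun y => gradient f y - hessian f x y)
      (hessian f y - hessian f x) (Metric.closedBall x S) y := fun y _ =>
    ((h.2.1 y).hasFDerivAt.sub (hessian f x).hasFDerivAt).hasFDerivWithinAt
  have := (convex_closedBall x S).norm_image_sub_le_of_norm_hasFDerivWithin_le (C := ρ * S) hd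
    (fun y hy => (h.2.2 y x).trans (by
      rw [Metric.mem_closedBall, dist_eq_norm] at hy; gcongr))
    (by rwa [Metric.mem_closedBall, dist_eq_norm] : u ∈ _)
    (by rwa [Metric.mem_closedBall, dist_eq_norm] : w ∈ _)
  have e : gradient f w - gradient f u - hessian f x (w - u) =
      gradient f w - hessian f x w - (gradient f u - hessian f x u) := by rw [map_sub]; abel
  rw [e]
  exact this

theorem le_add_of_norm_sub_le (hf : Differentiable ℝ f) {Λ : ℝ} (hΛ : 0 ≤ Λ)
    (h : ∀ x y, ‖gradient f x - gradient f y‖ ≤ Λ * ‖x - y‖) {r : ℝ}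
    {x y : EuclideanSpace ℝ (Fin d)} (hy : ‖y - x‖ ≤ r) :
    f y ≤ f x + (‖gradient f x‖ + Λ * r) * r := by
  have hr : 0 ≤ r := (norm_nonneg _).trans hy
  have := (convex_closedBall x r).norm_image_sub_le_of_norm_hasFDerivWithin_le
    (C := ‖gradient f x‖ + Λ * r) (f := f)
    (f' := fun y => InnerProductSpace.toDual ℝ _ (gradient f y))
    (fun y _ => (hf y).hasGradientAt.hasFDerivAt.hasFDerivWithinAt)
    (fun z hz => by
      rw [Metric.mem_closedBall, dist_eq_norm] at hz
      rw [LinearIsometryEquiv.norm_map]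
      have h1 := norm_add_le (gradient f x) (gradient f z - gradient f x)
      rw [add_sub_cancel] at h1
      refine h1.trans ?_
      gcongr
      exact (h z x).trans (by gcongr))
    (Metric.mem_closedBall_self hr)
    (by rwa [Metric.mem_closedBall, dist_eq_norm] : y ∈ _)
  have h2 := (le_abs_self _).trans this
  have h3 : (‖gradient f x‖ + Λ * r) * ‖y - x‖ ≤ (‖gradient f x‖ + Λ * r) * r := by gcongr
  linarith

/-- A direction of negative curvature allows a definite decrease. -/
theorem IsHessianLipschitz.exists_le_sub {ρ γ : ℝ} (h : IsHessianLipschitz f ρ) (hρ : 0 < ρ)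
    (hγ : 0 < γ) {x v : EuclideanSpace ℝ (Fin d)} (hv : ‖v‖ = 1) (hvH : ⟪v, hessian f x v⟫ ≤ -γ) :
    ∃ y, f y ≤ f x - γ ^ 3 / (16 * ρ ^ 2) := by
  wlog hg : ⟪gradient f x, v⟫ ≤ 0 generalizing v
  · exact this (v := -v) (by rwa [norm_neg]) (by simpa using hvH) (by
      rw [inner_neg_right]; linarith)
  set τ := γ / (2 * ρ) with hτ
  have hτ0 : 0 < τ := by positivity
  have hanti : AntitoneOn (fun s : ℝ => f (x + s • v) + γ / 4 * s ^ 2) (Set.Icc 0 τ) := by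
    have hd' : ∀ s : ℝ, HasDerivAt (fun s : ℝ => f (x + s • v) + γ / 4 * s ^ 2)
        (⟪gradient f (x + s • v), v⟫ + γ / 4 * (2 * s)) s := fun s => by
      simpa using (hasDerivAt_line h.1 x v s).fun_add ((hasDerivAt_pow 2 s).const_mul (γ / 4))
    refine antitoneOn_of_deriv_nonpos (convex_Icc 0 τ)
      (fun s _ => (hd' s).continuousAt.continuousWithinAt)
      (fun s _ => (hd' s).differentiableAt.differentiableWithinAt) fun s hs => ?_
    rw [interior_Icc] at hs
    rw [(hd' s).deriv]
    have hs0 := hs.1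
    have h1 := h.norm_gradient_sub_sub_le hρ.le (S := s) (x := x) (u := x) (w := x + s • v)
      (by simpa using hs0.le) (by simp [norm_smul, hv, abs_of_pos hs0])
    rw [add_sub_cancel_left, map_smul, norm_smul, hv,
      Real.norm_of_nonneg hs0.le] at h1
    have h2 := real_inner_le_norm (gradient f (x + s • v) - gradient f x - hessian f x (s • v)) v
    rw [hv, mul_one, inner_sub_left, inner_sub_left, map_smul, real_inner_smul_left,
      real_inner_comm v (hessian f x v)] at h2
    have h3 : ρ * s ≤ γ / 2 := by
      have := mul_le_mul_of_nonneg_left hs.2.le hρ.le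
      rw [hτ] at this
      refine this.trans (le_of_eq ?_)
      field_simp
    nlinarith
  refine ⟨x + τ • v, ?_⟩
  have := hanti (Set.left_mem_Icc.2 hτ0.le) (Set.right_mem_Icc.2 hτ0.le) hτ0.le
  simp only [zero_smul, add_zero] at this
  have e : γ / 4 * τ ^ 2 = γ ^ 3 / (16 * ρ ^ 2) := by rw [hτ]; field_simp; ring
  rw [e] at this
  linarith

theorem exists_unit_of_not_isSS2 {ε γ : ℝ} {x : EuclideanSpace ℝ (Fin d)}
    (hx : ‖gradient f x‖ ≤ ε) (h : ¬ IsSS2 f ε γ x) : ∃ v, ‖v‖ = 1 ∧ ⟪v, hessian f x v⟫ ≤ -γ := by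
  rw [IsSS2, not_and] at h
  have := h hx
  push Not at this
  obtain ⟨μ, hμ, hμγ⟩ := this
  obtain ⟨w, hw⟩ := hμ.exists_hasEigenvector
  have hw0 : ‖w‖ ≠ 0 := norm_ne_zero_iff.2 hw.2
  refine ⟨‖w‖⁻¹ • w, by rw [norm_smul, norm_inv, norm_norm, inv_mul_cancel₀ hw0], ?_⟩
  have h1 : hessian f x w = μ • w := hw.apply_eq_smul
  rw [map_smul, h1, real_inner_smul_left, real_inner_smul_right, real_inner_smul_right,
    real_inner_self_eq_norm_sq]
  have : ‖w‖⁻¹ * (‖w‖⁻¹ * (μ * ‖w‖ ^ 2)) = μ := by field_simp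
  rw [this]; exact hμγ.le

end

section

variable {d : ℕ} {blk : Fin d → Fin 2} {f : EuclideanSpace ℝ (Fin d) → ℝ} {Lb Lt : Fin 2 → ℝ}

theorem norm_agdStep_sub_altStep_le {ρ : ℝ} (hH : IsHessianLipschitz f ρ) (hρ : 0 ≤ ρ)
    {Λ η S : ℝ} (hΛ : ∀ x y, ‖gradient f x - gradient f y‖ ≤ Λ * ‖x - y‖) (hΛ0 : 0 ≤ Λ)
    (hη : 0 ≤ η) (hηΛ : η * Λ ≤ 1 / 4) (hS : 0 ≤ S) {x u w : EuclideanSpace ℝ (Fin d)}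
    (hu : ‖u - x‖ ≤ S) (hw : ‖w - x‖ ≤ S) (hu' : ‖agdHalf blk f η u - x‖ ≤ S)
    (hw' : ‖agdHalf blk f η w - x‖ ≤ S) :
    ‖(agdStep blk f η w - agdStep blk f η u) -
      altStep (blockProj blk 0) (blockProj blk 1) (hessian f x) η (w - u)‖ ≤
      4 * η * ρ * S * ‖w - u‖ := by
  have he₁ := hH.norm_gradient_sub_sub_le hρ hu hw
  have he₂ := hH.norm_gradient_sub_sub_le hρ hu' hw'
  set H := hessian f x
  set p := blockProj blk 0
  set q := blockProj blk 1
  set e₁ := gradient f w - gradient f u - H (w - u) with he₁'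
  set hv := agdHalf blk f η w - agdHalf blk f η u with hv'
  set e₂ := gradient f (agdHalf blk f η w) - gradient f (agdHalf blk f η u) - H hv with he₂'
  have hv1 : hv = (w - u) - η • p (gradient f w - gradient f u) := by
    rw [hv', agdHalf, agdHalf, blockGrad_eq, blockGrad_eq, map_sub, smul_sub]; abel
  have hv2 : hv = ((w - u) - η • p (H (w - u))) - η • p e₁ := by
    rw [hv1, he₁', map_sub p _ (H (w - u)), smul_sub]; abel
  have hdiff : agdStep blk f η w - agdStep blk f η u = hv - η • q (H hv + e₂) := by
    rw [he₂', hv', agdStep, agdStep, blockGrad_eq, blockGrad_eq, add_sub_cancel, map_sub,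
      smul_sub]
    abel
  have hvn : ‖hv‖ ≤ 5 / 4 * ‖w - u‖ := by
    have h1 : ‖η • p (gradient f w - gradient f u)‖ ≤ η * (Λ * ‖w - u‖) := by
      rw [norm_smul, Real.norm_of_nonneg hη]
      gcongr
      exact (norm_blockProj_le 0 _).trans (hΛ w u)
    rw [hv1]
    refine (norm_sub_le _ _).trans ?_
    nlinarith [norm_nonneg (w - u)]
  have hkey : (agdStep blk f η w - agdStep blk f η u) - altStep p q H η (w - u) =
      -(η • p e₁) + η • (η • q (H (p e₁))) - η • q e₂ := by
    rw [hdiff, altStep_apply]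
    have : (w - u) - η • p (H (w - u)) = hv + η • p e₁ := by rw [hv2]; abel
    rw [this]
    simp only [map_add, map_smul, smul_add]
    abel
  rw [hkey]
  have h1 : ‖η • p e₁‖ ≤ η * (ρ * S * ‖w - u‖) := by
    rw [norm_smul, Real.norm_of_nonneg hη]
    gcongr
    exact (norm_blockProj_le 0 _).trans he₁
  have h2 : ‖η • q e₂‖ ≤ η * (ρ * S * (5 / 4 * ‖w - u‖)) := by
    rw [norm_smul, Real.norm_of_nonneg hη]
    gcongr
    exact (norm_blockProj_le 1 _).trans (he₂.trans (by gcongr))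
  have h3 : ‖η • (η • q (H (p e₁)))‖ ≤ 1 / 4 * (η * (ρ * S * ‖w - u‖)) := by
    rw [norm_smul, norm_smul, Real.norm_of_nonneg hη]
    have h4 : ‖q (H (p e₁))‖ ≤ Λ * (ρ * S * ‖w - u‖) := by
      refine (norm_blockProj_le 1 _).trans ((norm_hessian_apply_le hΛ0 hΛ x _).trans ?_)
      gcongr
      exact (norm_blockProj_le 0 _).trans he₁
    calc η * (η * ‖q (H (p e₁))‖) ≤ η * (η * (Λ * (ρ * S * ‖w - u‖))) := by gcongr
      _ = (η * Λ) * (η * (ρ * S * ‖w - u‖)) := by ring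
      _ ≤ _ := by gcongr
  have h4 := norm_sub_le (-(η • p e₁) + η • (η • q (H (p e₁)))) (η • q e₂)
  have h5 := norm_add_le (-(η • p e₁)) (η • (η • q (H (p e₁))))
  rw [norm_neg] at h5
  have h6 : 0 ≤ η * (ρ * S * ‖w - u‖) := by positivity
  linarith

theorem IsBlockSmooth.antitone_iterate (h : IsBlockSmooth blk f Lb Lt) {η : ℝ} (hη : 0 ≤ η)
    (hηL : η * blockLmax Lb Lt ≤ 1 / 2) (u : EuclideanSpace ℝ (Fin d)) :
    Antitone fun n => f ((agdStep blk f η)^[n] u) := by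
  refine antitone_nat_of_succ_le fun n => ?_
  rw [Function.iterate_succ_apply']
  refine (h.agdStep_le hη hηL _).trans (sub_le_self _ ?_)
  rw [agdGradSq]
  positivity

/-- A trajectory along which the objective hardly decreases stays close to its starting point. -/
theorem IsBlockSmooth.norm_iterate_sub_le (h : IsBlockSmooth blk f Lb Lt)
    {η g F r : ℝ} (hη : 0 < η) (hL : 0 ≤ blockLmax Lb Lt) (hηL : η * blockLmax Lb Lt ≤ 1 / 4)
    (hr : 0 < r) (hg : 0 ≤ g) (hgr : g * r = F) (hrF : r ^ 2 = η * F)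
    {K : ℕ} (hK : 16 ≤ K) {x u : EuclideanSpace ℝ (Fin d)} (hx : agdGradSq blk f η x ≤ g ^ 2)
    (hu : ‖u - x‖ ≤ r) (hstuck : -F < f ((agdStep blk f η)^[K] u) - f x) :
    (∀ n ≤ K, ‖(agdStep blk f η)^[n] u - x‖ ≤ 4 * √K * r) ∧
      ∀ n < K, ‖agdHalf blk f η ((agdStep blk f η)^[n] u) - x‖ ≤ 4 * √K * r := by
  have hηL' : η * blockLmax Lb Lt ≤ 1 / 2 := by linarith
  have hanti := h.antitone_iterate hη.le hηL' u
  have hF : 0 ≤ F := by rw [← hgr]; positivity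
  have hfu : f u ≤ f x + 3 * F := by
    have h1 := le_add_of_norm_sub_le h.1 (by positivity) (h.norm_gradient_sub_le hL) hu
    have h2 := h.norm_gradient_le hη.le hηL' hg hx
    have h3 : blockLmax Lb Lt * r ^ 2 ≤ 1 / 4 * F := by rw [hrF]; nlinarith
    have h4 : ‖gradient f x‖ * r ≤ 2 * g * r := by gcongr
    nlinarith
  have hstep : ∀ n, ‖(agdStep blk f η)^[n + 1] u - (agdStep blk f η)^[n] u‖ ^ 2 ≤
      (2 * η) * (f ((agdStep blk f η)^[n] u) - f ((agdStep blk f η)^[n + 1] u)) := fun n => by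
    have h1 := h.agdStep_le hη.le hηL' ((agdStep blk f η)^[n] u)
    rw [Function.iterate_succ_apply', sq_norm_agdStep_sub]
    nlinarith
  have hK4 : 4 ≤ √K := Real.le_sqrt_of_sq_le (by norm_num; exact_mod_cast hK)
  have h8 : √8 ≤ 2.83 := Real.sqrt_le_iff.2 ⟨by norm_num, by norm_num⟩
  have hdrop : ∀ m n, n ≤ K →
      f ((agdStep blk f η)^[m] u) - f ((agdStep blk f η)^[n] u) ≤ 4 * F := fun m n hn => by
    have h1 := hanti (Nat.zero_le m)
    have h2 := hanti hn
    simp only [Function.iterate_zero, id_eq] at h1 h2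
    linarith
  have hn : ∀ n ≤ K, ‖(agdStep blk f η)^[n] u - u‖ ≤ √8 * √K * r := fun n hn => by
    have h1 := sq_norm_sub_le_of_drop (fun n => (agdStep blk f η)^[n] u)
      (fun n => f ((agdStep blk f η)^[n] u)) hstep n
    rw [← sq_le_sq₀ (norm_nonneg _) (by positivity), mul_pow, mul_pow, Real.sq_sqrt (by norm_num),
      Real.sq_sqrt (by positivity), hrF]
    refine h1.trans ?_
    have hn' : (n : ℝ) ≤ K := by exact_mod_cast hn
    calc (n : ℝ) * (2 * η * (f ((agdStep blk f η)^[0] u) - f ((agdStep blk f η)^[n] u)))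
        ≤ n * (2 * η * (4 * F)) := by gcongr; exact hdrop 0 n hn
      _ ≤ K * (2 * η * (4 * F)) := by gcongr
      _ = _ := by ring
  have hhalf : ∀ n < K, ‖agdHalf blk f η ((agdStep blk f η)^[n] u) -
      (agdStep blk f η)^[n] u‖ ≤ √8 * r := fun n hn => by
    refine (norm_agdHalf_sub_le η _).trans ?_
    rw [← sq_le_sq₀ (norm_nonneg _) (by positivity), mul_pow, Real.sq_sqrt (by norm_num), hrF,
      ← Function.iterate_succ_apply' (agdStep blk f η) n u]
    refine (hstep n).trans ?_
    have := mul_le_mul_of_nonneg_left (hdrop n (n + 1) hn) (by positivity : 0 ≤ 2 * η)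
    linarith
  have htri : ∀ a b c : EuclideanSpace ℝ (Fin d), ‖a - c‖ ≤ ‖a - b‖ + ‖b - c‖ :=
    fun a b c => norm_sub_le_norm_sub_add_norm_sub a b c
  have hKr : 4 * r ≤ √K * r := by gcongr
  have h8K : √8 * √K * r ≤ 2.83 * √K * r := by gcongr
  have h8r : √8 * r ≤ 2.83 * r := by gcongr
  refine ⟨fun n hnK => ?_, fun n hnK => ?_⟩
  · have h1 := htri ((agdStep blk f η)^[n] u) u x
    have h2 := hn n hnK
    linarith
  · have h1 := htri ((agdStep blk f η)^[n] u) u x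
    have h2 := hn n hnK.le
    have h3 := htri (agdHalf blk f η ((agdStep blk f η)^[n] u)) ((agdStep blk f η)^[n] u) x
    have h4 := hhalf n hnK
    linarith

/-- Near a strict saddle there is a direction along which two stuck starting points have to be
exponentially close. -/
theorem exists_escape_direction (h : IsBlockSmooth blk f Lb Lt) {ρ : ℝ}
    (hH : IsHessianLipschitz f ρ) (hρ : 0 ≤ ρ) {η g F r γ : ℝ} (hη : 0 < η)
    (hL : 0 ≤ blockLmax Lb Lt) (hηL : η * blockLmax Lb Lt ≤ 1 / 16)
    (hr : 0 < r) (hg : 0 ≤ g) (hgr : g * r = F) (hrF : r ^ 2 = η * F) {K : ℕ} (hK : 16 ≤ K)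
    (hKsmall : 2 * (2 * (1 + √(8 * K * (η * (4 * blockLmax Lb Lt))))) *
      (4 * η * ρ * (4 * √K * r)) * K ≤ 1 / 2)
    {x v : EuclideanSpace ℝ (Fin d)} (hx : agdGradSq blk f η x ≤ g ^ 2)
    (hγ : 0 < γ) (hv : ‖v‖ = 1) (hvH : ⟪v, hessian f x v⟫ ≤ -γ) :
    ∃ φ : EuclideanSpace ℝ (Fin d), ‖φ‖ = 1 ∧ ∀ (u : EuclideanSpace ℝ (Fin d)) (s : ℝ), 0 ≤ s →
      ‖u - x‖ ≤ r → ‖u + s • φ - x‖ ≤ r →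
      -F < f ((agdStep blk f η)^[K] u) - f x →
      -F < f ((agdStep blk f η)^[K] (u + s • φ)) - f x →
      (1 + η * γ / 2) ^ K * s ≤ 16 * √K * r := by
  have hΛ := h.norm_gradient_sub_le hL
  have hηΛ : η * (4 * blockLmax Lb Lt) ≤ 1 / 4 := by linarith
  obtain ⟨l, hl, ⟨φ, hφ, hφA⟩, hA⟩ := exists_left_eigenvector (isBlockSplit_blockProj blk)
    (hH.inner_hessian_comm x) (norm_hessian_apply_le (by positivity) hΛ x) hη hηΛ hγ hv hvH
  refine ⟨φ, hφ, fun u s hs hu hw hsu hsw => ?_⟩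
  have hηL' : η * blockLmax Lb Lt ≤ 1 / 4 := by linarith
  obtain ⟨hu1, hu2⟩ := h.norm_iterate_sub_le hη hL hηL' hr hg hgr hrF hK hx hu hsu
  obtain ⟨hw1, hw2⟩ := h.norm_iterate_sub_le hη hL hηL' hr hg hgr hrF hK hx hw hsw
  have hl1 : 1 ≤ l := by
    have : 0 ≤ η * γ / 2 := by positivity
    linarith
  have key := le_norm_of_perturbed (K := K)
    (v := fun n => (agdStep blk f η)^[n] (u + s • φ) - (agdStep blk f η)^[n] u) hl1
    (C := 2 * (1 + √(8 * K * (η * (4 * blockLmax Lb Lt))))) (κ := 4 * η * ρ * (4 * √K * r))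
    (by linarith [Real.sqrt_nonneg (8 * K * (η * (4 * blockLmax Lb Lt)))]) (by positivity) hs
    hφ hφA (fun n hn w => (hA n w).trans (by gcongr)) (by simp)
    (fun n hn => by
      rw [Function.iterate_succ_apply', Function.iterate_succ_apply']
      exact norm_agdStep_sub_altStep_le hH hρ hΛ (by positivity) hη.le hηΛ (by positivity)
        (hu1 n hn.le) (hw1 n hn.le) (hu2 n hn) (hw2 n hn)) hKsmall
  have h1 := norm_sub_le_norm_sub_add_norm_sub ((agdStep blk f η)^[K] (u + s • φ)) x
    ((agdStep blk f η)^[K] u)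
  rw [norm_sub_rev x] at h1
  have h2 : (1 + η * γ / 2) ^ K * s ≤ l ^ K * s := by gcongr
  have h3 := hu1 K le_rfl
  have h4 := hw1 K le_rfl
  linarith

end

section

variable {d : ℕ}

/-- A set that meets every line in a fixed direction in points at distance less than `r / (d m)`
has small uniform measure: `m` of its translates are disjoint subsets of a slightly larger ball. -/
theorem uniformBall_le_of_thin (hd : 0 < d) {r : ℝ} (hr : 0 < r) {m : ℕ} (hm : 0 < m)
    {A : Set (EuclideanSpace ℝ (Fin d))} (hA : MeasurableSet A) {φ : EuclideanSpace ℝ (Fin d)}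
    (hφ : ‖φ‖ = 1)
    (hthin : ∀ (u : EuclideanSpace ℝ (Fin d)) (s : ℝ), 0 ≤ s → ‖u‖ ≤ r → ‖u + s • φ‖ ≤ r →
      u ∈ A → u + s • φ ∈ A → s < r / (d * m)) :
    uniformBall d r A ≤ ENNReal.ofReal (3 / m) := by
  have hd' : (0 : ℝ) < d := by exact_mod_cast hd
  have hm' : (0 : ℝ) < m := by exact_mod_cast hm
  set w := r / (d * m) with hw
  have hw0 : 0 < w := by positivity
  set B := Metric.ball (0 : EuclideanSpace ℝ (Fin d)) r with hB
  let T : ℕ → Set (EuclideanSpace ℝ (Fin d)) := fun j => (fun y => y + -((j * w) • φ)) ⁻¹' (B ∩ A)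
  have hTmeas : ∀ j, MeasurableSet (T j) := fun j =>
    (measurable_add_const _) (Metric.isOpen_ball.measurableSet.inter hA)
  have hdisj : ∀ j k, j < k → Disjoint (T j) (T k) := fun j k hjk => by
    rw [Set.disjoint_left]
    rintro y ⟨hyj, hyj'⟩ ⟨hyk, hyk'⟩
    simp only [hB, mem_ball_zero_iff] at hyj hyk
    have hs : ((k - j : ℕ) : ℝ) = k - j := by rw [Nat.cast_sub hjk.le]
    have e : y + -((k * w) • φ) + (((k - j : ℕ) : ℝ) * w) • φ = y + -((j * w) • φ) := by
      rw [hs]; module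
    have h1 := hthin (y + -((k * w) • φ)) (((k - j : ℕ) : ℝ) * w) (by positivity) hyk.le
      (by rw [e]; exact hyj.le) hyk' (by rw [e]; exact hyj')
    have h2 : (1 : ℝ) ≤ (k - j : ℕ) := by
      have : 1 ≤ k - j := by omega
      exact_mod_cast this
    nlinarith
  have hsub : (⋃ j ∈ Finset.range m, T j) ⊆ Metric.ball 0 (r * (1 + 1 / d)) := by
    refine Set.iUnion₂_subset fun j hj y hy => ?_
    have h1 := hy.1
    simp only [hB, mem_ball_zero_iff] at h1 ⊢
    have h2 := norm_add_le (y + -((j * w) • φ)) ((j * w) • φ)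
    rw [neg_add_cancel_right, norm_smul (_ * _), hφ, Real.norm_of_nonneg (by positivity)] at h2
    have h3 : (j : ℝ) * w ≤ m * w := by
      have : (j : ℝ) ≤ m := by exact_mod_cast (Finset.mem_range.1 hj).le
      gcongr
    have h4 : m * w = r * (1 / d) := by rw [hw]; field_simp
    rw [h4] at h3
    linarith
  have hvol : (m : ENNReal) * volume (B ∩ A) ≤ 3 * volume B := by
    calc (m : ENNReal) * volume (B ∩ A) = ∑ j ∈ Finset.range m, volume (T j) := by
          have : ∀ j, volume (T j) = volume (B ∩ A) := fun j => measure_preimage_add_right _ _ _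
          simp [this]
      _ = volume (⋃ j ∈ Finset.range m, T j) :=
          (measure_biUnion_finset (fun j _ k _ hjk => by
            rcases lt_or_gt_of_ne hjk with h | h
            · exact hdisj j k h
            · exact (hdisj k j h).symm) fun j _ => hTmeas j).symm
      _ ≤ volume (Metric.ball (0 : EuclideanSpace ℝ (Fin d)) (r * (1 + 1 / d))) :=
          measure_mono hsub
      _ ≤ 3 * volume B := by
          rw [hB, Measure.addHaar_ball_of_pos _ _ (by positivity),
            Measure.addHaar_ball_of_pos _ _ hr,
            ← mul_assoc]
          gcongr
          rw [finrank_euclideanSpace_fin, mul_pow, ENNReal.ofReal_mul (by positivity), mul_comm]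
          gcongr
          have h1 : (1 + 1 / (d : ℝ)) ^ d ≤ Real.exp 1 := by
            calc (1 + 1 / (d : ℝ)) ^ d ≤ Real.exp (1 / d) ^ d := by
                  gcongr; linarith [Real.add_one_le_exp (1 / (d : ℝ))]
              _ = Real.exp 1 := by rw [← Real.exp_nat_mul]; congr 1; field_simp
          have h2 : (1 + 1 / (d : ℝ)) ^ d ≤ 3 := h1.trans (by linarith [Real.exp_one_lt_d9])
          calc ENNReal.ofReal ((1 + 1 / (d : ℝ)) ^ d) ≤ ENNReal.ofReal 3 :=
                ENNReal.ofReal_le_ofReal h2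
            _ = 3 := by simp
  have hB0 : volume B ≠ 0 := (Metric.measure_ball_pos volume 0 hr).ne'
  have hBt : volume B ≠ ⊤ := measure_ball_lt_top.ne
  rw [uniformBall, cond_apply Metric.isOpen_ball.measurableSet, mul_comm, ← div_eq_mul_inv,
    ENNReal.div_le_iff hB0 hBt, ENNReal.ofReal_div_of_pos hm', ENNReal.ofReal_natCast,
    ENNReal.mul_comm_div, ← mul_div_assoc, ENNReal.le_div_iff_mul_le (by simp [hm.ne']) (by simp),
    mul_comm]
  simpa using hvol

end

namespace PAGDParams

/-- The standing assumptions on the parameters. -/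
structure Admissible (p : PAGDParams) : Prop where
  d_pos : 0 < p.d
  c_pos : 0 < p.c
  c_le : p.c ≤ 1 / 10000
  Lmax_pos : 0 < p.Lmax
  Lmax_le : p.Lmax ≤ p.L
  ρ_pos : 0 < p.ρ
  ε_pos : 0 < p.ε
  ε_le : p.ε ≤ p.Lmax ^ 2 / p.ρ
  δ_pos : 0 < p.δ
  δ_le : p.δ ≤ 1
  Δ_nonneg : 0 ≤ p.Δ

namespace Admissible

variable {p : PAGDParams}

theorem two_le_P₁ (hp : p.Admissible) : 2 ≤ p.P₁ := by
  have := (one_le_div hp.Lmax_pos).2 hp.Lmax_le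
  rw [P₁]; linarith

theorem one_le_P₂ (hp : p.Admissible) : 1 ≤ p.P₂ := by
  have h1 : (1 : ℝ) ≤ p.d := by exact_mod_cast hp.d_pos
  have h2 : 0 ≤ Real.log (2 * (p.d : ℝ)) := Real.log_nonneg (by linarith)
  have h3 := hp.Lmax_pos
  have h4 : 0 ≤ p.L := by linarith [hp.Lmax_le]
  rw [P₂]
  have : 0 ≤ p.L * Real.log (2 * (p.d : ℝ)) / p.Lmax := by positivity
  linarith

theorem le_χ : 24 ≤ p.χ := by
  rw [χ]; linarith [le_max_right p.logFactor 4]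

theorem γ_pos (hp : p.Admissible) : 0 < p.γ := by
  have := hp.Lmax_pos; have := hp.ρ_pos; have := hp.ε_pos
  rw [γ]; positivity

theorem γ_cube (hp : p.Admissible) : p.γ ^ 3 = p.Lmax * p.ρ * p.ε := by
  have := hp.Lmax_pos; have := hp.ρ_pos; have := hp.ε_pos
  rw [γ, ← Real.rpow_natCast, ← Real.rpow_mul (by positivity)]
  norm_num

theorem γ_le (hp : p.Admissible) : p.γ ≤ p.Lmax := by
  have h := hp.ε_le
  rw [le_div_iff₀ hp.ρ_pos] at h
  refine le_of_pow_le_pow_left₀ (n := 3) (by norm_num) hp.Lmax_pos.le ?_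
  rw [hp.γ_cube]
  nlinarith [hp.Lmax_pos]

theorem rpow_quotient (hp : p.Admissible) (a : ℝ) :
    p.Lmax ^ ((5 : ℝ) / 3) * a / (p.ρ ^ ((1 : ℝ) / 3) * p.ε ^ ((7 : ℝ) / 3)) =
      p.Lmax ^ 2 * a / (p.γ * p.ε ^ 2) := by
  have h1 := hp.Lmax_pos
  have h2 := hp.ρ_pos
  have h3 := hp.ε_pos
  have e1 : p.Lmax ^ 2 = p.Lmax ^ ((5 : ℝ) / 3) * p.Lmax ^ ((1 : ℝ) / 3) := by
    rw [← Real.rpow_add h1, ← Real.rpow_natCast]; norm_num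
  have e2 : p.ε ^ ((7 : ℝ) / 3) = p.ε ^ 2 * p.ε ^ ((1 : ℝ) / 3) := by
    rw [← Real.rpow_natCast, ← Real.rpow_add h3]; norm_num
  rw [γ, Real.mul_rpow (by positivity) h3.le, Real.mul_rpow h1.le h2.le, e1, e2]
  field_simp

theorem rate_eq (hp : p.Admissible) :
    p.rate = p.Lmax ^ 2 * p.P₁ ^ 7 * p.P₂ ^ 2 * p.Δ / (p.γ * p.ε ^ 2) := by
  have := hp.rpow_quotient (p.P₁ ^ 7 * p.P₂ ^ 2 * p.Δ)
  rw [rate]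
  simpa only [mul_assoc] using this

theorem logFactor_eq (hp : p.Admissible) : p.logFactor =
    Real.log (p.P₁ ^ 6 * p.P₂ ^ 2 * p.d * p.Lmax ^ 2 * p.Δ / (p.c ^ 5 * p.γ * p.ε ^ 2 * p.δ)) := by
  have := hp.rpow_quotient (p.P₁ ^ 6 * p.P₂ ^ 2 * p.d * p.Δ / (p.c ^ 5 * p.δ))
  have h1 := hp.c_pos; have h2 := hp.δ_pos
  rw [logFactor]
  congr 1
  calc _ = _ := by field_simp
    _ = _ := this
    _ = _ := by field_simp

theorem pos_all (hp : p.Admissible) : 0 < p.c ∧ 0 < p.Lmax ∧ 0 < p.ρ ∧ 0 < p.ε ∧ 0 < p.δ ∧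
    0 < p.γ ∧ 0 < p.P₁ ∧ 0 < p.P₂ ∧ 0 < p.χ :=
  ⟨hp.c_pos, hp.Lmax_pos, hp.ρ_pos, hp.ε_pos, hp.δ_pos, hp.γ_pos, by linarith [hp.two_le_P₁],
    by linarith [hp.one_le_P₂], by linarith [le_χ (p := p)]⟩

theorem η_mul_Lmax (hp : p.Admissible) : p.η * p.Lmax = p.c := by
  have := hp.Lmax_pos
  rw [η]; field_simp

theorem gth_mul_r (hp : p.Admissible) : p.gth * p.r = p.fth := by
  obtain ⟨h1, h2, h3, h4, h5, h6, h7, h8, h9⟩ := hp.pos_all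
  rw [gth, r, fth]; field_simp

theorem sq_r (hp : p.Admissible) : p.r ^ 2 = p.η * p.fth := by
  obtain ⟨h1, h2, h3, h4, h5, h6, h7, h8, h9⟩ := hp.pos_all
  rw [η, r, fth]; field_simp

theorem η_mul_sq_gth (hp : p.Admissible) : p.η * p.gth ^ 2 = p.fth := by
  obtain ⟨h1, h2, h3, h4, h5, h6, h7, h8, h9⟩ := hp.pos_all
  rw [η, gth, fth]; field_simp

theorem pos_derived (hp : p.Admissible) :
    0 < p.η ∧ 0 < p.r ∧ 0 < p.gth ∧ 0 < p.fth ∧ 0 < p.tth := by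
  obtain ⟨h1, h2, h3, h4, h5, h6, h7, h8, h9⟩ := hp.pos_all
  rw [η, r, gth, fth, tth]
  refine ⟨?_, ?_, ?_, ?_, ?_⟩ <;> positivity

theorem le_χ_mul_P₁ (hp : p.Admissible) : 48 ≤ p.χ * p.P₁ := by
  nlinarith [le_χ (p := p), hp.two_le_P₁]

theorem one_le_pow_mul (hp : p.Admissible) (k : ℕ) : 1 ≤ (p.χ * p.P₁) ^ k :=
  one_le_pow₀ (by linarith [hp.le_χ_mul_P₁])

theorem two_mul_gth_le (hp : p.Admissible) : 2 * p.gth ≤ p.ε := by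
  obtain ⟨h1, h2, h3, h4, h5, h6, h7, h8, h9⟩ := hp.pos_all
  have hc := hp.c_le
  have h10 := one_le_mul_of_one_le_of_one_le (hp.one_le_pow_mul 3) hp.one_le_P₂
  rw [gth, ← mul_div_assoc, div_le_iff₀ (by positivity)]
  have : 2 * p.c ^ 2 ≤ 1 := by nlinarith
  nlinarith

theorem fth_le (hp : p.Admissible) : p.fth ≤ p.ε ^ 2 / (16 * p.Lmax) := by
  obtain ⟨h1, h2, h3, h4, h5, h6, h7, h8, h9⟩ := hp.pos_all
  have hc := hp.c_le
  have h10 := one_le_mul_of_one_le_of_one_le (hp.one_le_pow_mul 6)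
    (one_le_pow₀ hp.one_le_P₂ (n := 2))
  have h11 : 16 * p.c ^ 5 ≤ 1 := by
    have : p.c ^ 5 ≤ (1 / 10000) ^ 5 := by gcongr
    norm_num at this; linarith
  rw [fth, div_le_div_iff₀ (by positivity) (by positivity)]
  calc p.c ^ 5 * p.ε ^ 2 * (16 * p.Lmax) = (16 * p.c ^ 5) * (p.ε ^ 2 * p.Lmax) := by ring
    _ ≤ 1 * (p.ε ^ 2 * p.Lmax) := by gcongr
    _ ≤ ((p.χ * p.P₁) ^ 6 * p.P₂ ^ 2) * (p.ε ^ 2 * p.Lmax) := by gcongr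
    _ = _ := by ring

theorem le_tth (hp : p.Admissible) : 48 / p.c ^ 2 ≤ p.tth := by
  obtain ⟨h1, h2, h3, h4, h5, h6, h7, h8, h9⟩ := hp.pos_all
  rw [tth, div_le_div_iff₀ (by positivity) (by positivity)]
  calc 48 * (p.c ^ 2 * p.γ) ≤ (p.χ * p.P₁) * (p.c ^ 2 * p.Lmax) := by
        gcongr
        · exact hp.le_χ_mul_P₁
        · exact hp.γ_le
    _ = _ := by ring

theorem one_le_c_mul_tth (hp : p.Admissible) : 1 ≤ p.c * p.tth := by
  have h1 := hp.c_pos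
  have h2 := mul_le_mul_of_nonneg_left hp.le_tth h1.le
  have h3 : p.c * (48 / p.c ^ 2) = 48 / p.c := by field_simp
  have h4 : 1 ≤ 48 / p.c := by rw [one_le_div h1]; linarith [hp.c_le]
  linarith

theorem le_tth' (hp : p.Admissible) : 100 ≤ p.tth := by
  have h1 := hp.one_le_c_mul_tth
  nlinarith [hp.c_le, hp.c_pos]

theorem ceil_tth_le (hp : p.Admissible) : (⌈p.tth⌉₊ : ℝ) ≤ 2 * p.tth := by
  have := (Nat.ceil_lt_add_one (by linarith [hp.le_tth'] : 0 ≤ p.tth)).le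
  linarith [hp.le_tth']

theorem le_ceil_tth (hp : p.Admissible) : 16 ≤ ⌈p.tth⌉₊ := by
  have h1 := Nat.le_ceil p.tth
  have : (16 : ℝ) ≤ ⌈p.tth⌉₊ := by linarith [hp.le_tth']
  exact_mod_cast this

theorem linearization_error_le (hp : p.Admissible) :
    2 * (2 * (1 + √(8 * ⌈p.tth⌉₊ * (p.η * (4 * p.Lmax))))) *
      (4 * p.η * p.ρ * (4 * √⌈p.tth⌉₊ * p.r)) * ⌈p.tth⌉₊ ≤ 1 / 2 := by
  obtain ⟨h1, h2, h3, h4, h5, h6, h7, h8, h9⟩ := hp.pos_all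
  obtain ⟨hη, hr, -, -, ht⟩ := hp.pos_derived
  have hK0 : p.tth ≤ ⌈p.tth⌉₊ := Nat.le_ceil _
  have hK := hp.ceil_tth_le
  set K : ℝ := (⌈p.tth⌉₊ : ℝ)
  have hKpos : 0 < K := by linarith
  have hcK : 1 ≤ p.c * K := hp.one_le_c_mul_tth.trans (by gcongr)
  have hc : √p.c ≤ 1 / 100 := Real.sqrt_le_iff.2 ⟨by norm_num, by linarith [hp.c_le]⟩
  have e1 : √(8 * K * (p.η * (4 * p.Lmax))) ≤ 6 * (√p.c * √K) := by
    rw [← Real.sqrt_mul h1.le]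
    refine Real.sqrt_le_iff.2 ⟨by positivity, ?_⟩
    rw [mul_pow, Real.sq_sqrt (by positivity), mul_left_comm p.η, hp.η_mul_Lmax]
    nlinarith
  have e2 : 1 ≤ √p.c * √K := by
    rw [← Real.sqrt_mul h1.le]; exact Real.one_le_sqrt.2 hcK
  have e3 : p.η * p.ρ * p.r * K ^ 2 ≤ 1 / 12 := by
    have : p.η * p.ρ * p.r * (2 * p.tth) ^ 2 = 4 * p.γ / (p.Lmax * (p.χ * p.P₁) * p.P₂) := by
      have h10 : p.Lmax * p.ρ * p.ε = p.γ ^ 3 := hp.γ_cube.symm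
      rw [η, r, tth]
      field_simp
      linear_combination 4 * h10
    calc p.η * p.ρ * p.r * K ^ 2 ≤ p.η * p.ρ * p.r * (2 * p.tth) ^ 2 := by gcongr
      _ = _ := this
      _ ≤ 4 * p.Lmax / (p.Lmax * 48 * 1) := by
        gcongr
        · exact hp.γ_le
        · exact hp.le_χ_mul_P₁
        · exact hp.one_le_P₂
      _ = _ := by field_simp; norm_num
  calc 2 * (2 * (1 + √(8 * K * (p.η * (4 * p.Lmax))))) * (4 * p.η * p.ρ * (4 * √K * p.r)) * K
      ≤ 2 * (2 * (√p.c * √K + 6 * (√p.c * √K))) * (4 * p.η * p.ρ * (4 * √K * p.r)) * K := by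
        gcongr
    _ = 448 * √p.c * (p.η * p.ρ * p.r * (√K ^ 2 * K)) := by ring
    _ = 448 * √p.c * (p.η * p.ρ * p.r * K ^ 2) := by rw [Real.sq_sqrt hKpos.le]; ring
    _ ≤ 448 * (1 / 100) * (1 / 12) := by gcongr
    _ ≤ 1 / 2 := by norm_num

theorem exp_half_mul_le_one_add_pow {y : ℝ} (hy : 0 ≤ y) (hy1 : y ≤ 1) (n : ℕ) :
    Real.exp (n * (y / 2)) ≤ (1 + y) ^ n := by
  rw [Real.exp_nat_mul]
  gcongr
  have h1 := Real.one_sub_le_exp_neg (y / 2)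
  have h2 : Real.exp (y / 2) * Real.exp (-(y / 2)) = 1 := by rw [← Real.exp_add]; simp
  have h3 := Real.exp_pos (y / 2)
  nlinarith

theorem growth_gt (hp : p.Admissible) (hΔ : p.fth ≤ p.Δ) {m : ℕ} (hm : 0 < m)
    (hm' : (m : ℝ) ≤ 7 * p.Δ / (p.fth * p.δ)) :
    16 * √⌈p.tth⌉₊ * p.r < (1 + p.η * p.γ / 2) ^ ⌈p.tth⌉₊ * (p.r / (p.d * m)) := by
  obtain ⟨h1, h2, h3, h4, h5, h6, h7, h8, h9⟩ := hp.pos_all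
  obtain ⟨hη, hr, -, hf, ht⟩ := hp.pos_derived
  have hK0 : p.tth ≤ ⌈p.tth⌉₊ := Nat.le_ceil _
  have hK := hp.ceil_tth_le
  have hΔ0 : 0 < p.Δ := hf.trans_le hΔ
  have hd : (0 : ℝ) < p.d := by exact_mod_cast hp.d_pos
  have hmr : (0 : ℝ) < m := by exact_mod_cast hm
  set X := p.χ * p.P₁ with hX
  have hX48 : 48 ≤ X := hp.le_χ_mul_P₁
  have hy : p.η * p.γ / 2 ≤ 1 := by
    have : p.η * p.γ ≤ p.η * p.Lmax := by gcongr; exact hp.γ_le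
    rw [hp.η_mul_Lmax] at this
    linarith [hp.c_le]
  have hexp : Real.exp (X / (4 * p.c)) ≤ (1 + p.η * p.γ / 2) ^ ⌈p.tth⌉₊ := by
    refine le_trans (Real.exp_le_exp.2 ?_) (exp_half_mul_le_one_add_pow (by positivity) hy _)
    calc X / (4 * p.c) = p.tth * (p.η * p.γ / 2 / 2) := by
          rw [hX, tth, η]; field_simp; norm_num
      _ ≤ _ := by gcongr
  set Z := p.P₁ ^ 6 * p.P₂ ^ 2 * p.d * p.Lmax ^ 2 * p.Δ / (p.c ^ 5 * p.γ * p.ε ^ 2 * p.δ) with hZ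
  have hZ0 : 0 < Z := by positivity
  have hZexp : Z ≤ Real.exp X := by
    rw [← Real.exp_log hZ0, hZ, ← hp.logFactor_eq]
    refine Real.exp_le_exp.2 ?_
    have h10 : p.χ = 6 * max p.logFactor 4 := rfl
    have := le_max_left p.logFactor 4
    have := le_max_right p.logFactor 4
    have := hp.two_le_P₁
    nlinarith
  have hdm : p.d * m ≤ 7 * Z * p.χ ^ 6 * p.γ / p.Lmax := by
    calc p.d * (m : ℝ) ≤ p.d * (7 * p.Δ / (p.fth * p.δ)) := by gcongr
      _ = _ := by rw [hZ, fth]; field_simp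
  have hsq : √⌈p.tth⌉₊ ≤ (⌈p.tth⌉₊ : ℝ) := by
    have : (1 : ℝ) ≤ ⌈p.tth⌉₊ := by linarith [hp.le_tth']
    exact Real.sqrt_le_iff.2 ⟨by linarith, by nlinarith⟩
  have hmain : 16 * √⌈p.tth⌉₊ * (p.d * m) < Real.exp (X / (4 * p.c)) := by
    have hX7 : X ^ 7 ≤ 5040 * Real.exp X := by
      have := Real.pow_div_factorial_le_exp X (by linarith) 7
      rw [div_le_iff₀ (by positivity)] at this
      norm_num [Nat.factorial] at this
      linarith
    have hX5 : 224 * 5040 ≤ Real.exp X := by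
      have h10 := Real.pow_div_factorial_le_exp X (by linarith) 5
      have h11 : (48 : ℝ) ^ 5 / (5).factorial ≤ X ^ 5 / (5).factorial := by gcongr
      norm_num [Nat.factorial] at h10 h11
      linarith
    have hc2 : 1 / p.c ^ 2 ≤ Real.exp (2 / p.c) := by
      have h10 := Real.add_one_le_exp (1 / p.c)
      have h11 : 1 / p.c ≤ Real.exp (1 / p.c) := by linarith
      calc 1 / p.c ^ 2 = (1 / p.c) ^ 2 := by field_simp
        _ ≤ Real.exp (1 / p.c) ^ 2 := by gcongr
        _ = Real.exp (2 / p.c) := by rw [← Real.exp_nat_mul]; congr 1; push_cast; ring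
    have hχ7 : p.χ ^ 7 * p.P₁ ≤ 5040 * Real.exp X := by
      refine le_trans ?_ hX7
      rw [hX, mul_pow]
      gcongr
      exact le_self_pow₀ (by linarith [hp.two_le_P₁]) (by norm_num)
    calc 16 * √⌈p.tth⌉₊ * (p.d * m)
        ≤ 16 * (2 * p.tth) * (7 * Z * p.χ ^ 6 * p.γ / p.Lmax) := by
          gcongr; exact hsq.trans hK
      _ = 224 * Z * (p.χ ^ 7 * p.P₁) * (1 / p.c ^ 2) := by rw [tth]; field_simp; norm_num
      _ ≤ 224 * Real.exp X * (5040 * Real.exp X) * Real.exp (2 / p.c) := by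
          have hY : 0 ≤ p.χ ^ 7 * p.P₁ := by positivity
          generalize p.χ ^ 7 * p.P₁ = Y at hχ7 hY
          gcongr
      _ = (224 * 5040) * (Real.exp X * Real.exp X * Real.exp (2 / p.c)) := by ring
      _ ≤ Real.exp X * (Real.exp X * Real.exp X * Real.exp (2 / p.c)) := by gcongr
      _ = Real.exp (3 * X + 2 / p.c) := by
          rw [← Real.exp_add, ← Real.exp_add, ← Real.exp_add]; congr 1; ring
      _ < Real.exp (X / (4 * p.c)) := by
          refine Real.exp_lt_exp.2 ?_
          have hc := hp.c_le
          rw [lt_div_iff₀ (by positivity), add_mul]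
          have : 2 / p.c * (4 * p.c) = 8 := by field_simp; norm_num
          rw [this]
          nlinarith
  rw [← mul_div_assoc, lt_div_iff₀ (by positivity)]
  calc 16 * √⌈p.tth⌉₊ * p.r * (p.d * m) = (16 * √⌈p.tth⌉₊ * (p.d * m)) * p.r := by ring
    _ < Real.exp (X / (4 * p.c)) * p.r := by gcongr
    _ ≤ _ := by gcongr

theorem exists_translate_count (hp : p.Admissible) (hΔ : p.fth ≤ p.Δ) :
    ∃ m : ℕ, 0 < m ∧ (m : ℝ) ≤ 7 * p.Δ / (p.fth * p.δ) ∧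
      3 / m * (p.Δ / p.fth + 1) ≤ p.δ := by
  obtain ⟨-, -, -, hf, -⟩ := hp.pos_derived
  have hδ := hp.δ_pos
  have hΔ0 : 0 < p.Δ := hf.trans_le hΔ
  have h1 : 1 ≤ p.Δ / p.fth := (one_le_div hf).2 hΔ
  have h2 : 1 ≤ p.Δ / (p.fth * p.δ) := by
    rw [one_le_div (by positivity)]; nlinarith [hp.δ_le]
  refine ⟨⌈6 * (p.Δ / (p.fth * p.δ))⌉₊, Nat.ceil_pos.2 (by positivity), ?_, ?_⟩
  · have := (Nat.ceil_lt_add_one (by positivity : 0 ≤ 6 * (p.Δ / (p.fth * p.δ)))).le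
    rw [mul_div_assoc]; linarith
  · have h3 := Nat.le_ceil (6 * (p.Δ / (p.fth * p.δ)))
    have h4 : 0 < 6 * (p.Δ / (p.fth * p.δ)) := by positivity
    calc 3 / (⌈6 * (p.Δ / (p.fth * p.δ))⌉₊ : ℝ) * (p.Δ / p.fth + 1)
        ≤ 3 / (6 * (p.Δ / (p.fth * p.δ))) * (p.Δ / p.fth + p.Δ / p.fth) := by gcongr
      _ = p.δ := by field_simp; norm_num

theorem iteration_bound_le (hp : p.Admissible) {T : ℝ}
    (hT : T ≤ (⌈p.tth⌉₊ + 1) * (p.Δ / p.fth + 1)) :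
    T ≤ 3 * 6 ^ 7 / p.c ^ 7 * (p.rate * max p.logFactor 4 ^ 7 + p.tth) := by
  obtain ⟨h1, h2, h3, h4, h5, h6, h7, h8, h9⟩ := hp.pos_all
  obtain ⟨-, -, -, hf, ht⟩ := hp.pos_derived
  have hΔ := hp.Δ_nonneg
  have h10 : p.tth * (p.Δ / p.fth) = 6 ^ 7 / p.c ^ 7 * (p.rate * max p.logFactor 4 ^ 7) := by
    have hχ : p.χ = 6 * max p.logFactor 4 := rfl
    rw [hp.rate_eq, tth, fth, hχ]
    have : 0 < max p.logFactor 4 := by rw [lt_max_iff]; right; norm_num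
    field_simp
  have h11 : 1 ≤ 6 ^ 7 / p.c ^ 7 := by
    rw [one_le_div (by positivity)]
    exact (pow_le_one₀ h1.le (by linarith [hp.c_le])).trans (by norm_num)
  calc T ≤ _ := hT
    _ ≤ (2 * p.tth + p.tth) * (p.Δ / p.fth + 1) := by
      gcongr
      · exact hp.ceil_tth_le
      · linarith [hp.le_tth']
    _ = 3 * (p.tth * (p.Δ / p.fth)) + 3 * 1 * p.tth := by ring
    _ ≤ 3 * (p.tth * (p.Δ / p.fth)) + 3 * (6 ^ 7 / p.c ^ 7) * p.tth := by gcongr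
    _ = _ := by rw [h10]; ring

theorem four_le_logFactor (hp : p.Admissible) (hΔ : p.ε ^ 2 / p.Lmax ≤ p.Δ) : 4 ≤ p.logFactor := by
  obtain ⟨h1, h2, h3, h4, h5, h6, h7, h8, h9⟩ := hp.pos_all
  have hd : (1 : ℝ) ≤ p.d := by exact_mod_cast hp.d_pos
  have hΔ0 : 0 < p.Δ := lt_of_lt_of_le (by positivity) hΔ
  have hc5 : p.c ^ 5 ≤ 1 / 100 := by
    calc p.c ^ 5 ≤ (1 / 10000) ^ 5 := by gcongr; exact hp.c_le
      _ ≤ _ := by norm_num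
  rw [hp.logFactor_eq, Real.le_log_iff_exp_le (by positivity)]
  have he : Real.exp 4 ≤ 100 := by
    have : Real.exp 4 = Real.exp 1 ^ 4 := by rw [← Real.exp_nat_mul]; norm_num
    rw [this]
    calc Real.exp 1 ^ 4 ≤ 2.72 ^ 4 := by gcongr; linarith [Real.exp_one_lt_d9]
      _ ≤ 100 := by norm_num
  refine he.trans ?_
  calc (100 : ℝ) = 1 ^ 6 * 1 ^ 2 * 1 * p.Lmax ^ 2 * (p.ε ^ 2 / p.Lmax) /
        (1 / 100 * p.Lmax * p.ε ^ 2 * 1) := by field_simp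
    _ ≤ _ := by
      gcongr
      · linarith [hp.two_le_P₁]
      · exact hp.one_le_P₂
      · exact hp.γ_le
      · exact hp.δ_le

theorem tth_le_of_le_Δ (hp : p.Admissible) (hΔ : p.ε ^ 2 / p.Lmax ≤ p.Δ) :
    p.tth ≤ 6 / p.c ^ 2 * (p.rate * p.logFactor ^ 7) := by
  obtain ⟨h1, h2, h3, h4, h5, h6, h7, h8, h9⟩ := hp.pos_all
  have hl := hp.four_le_logFactor hΔ
  have hχ : p.χ = 6 * p.logFactor := by rw [χ, max_eq_left hl]
  have hrate : p.Lmax * p.P₁ / p.γ ≤ p.rate := by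
    rw [hp.rate_eq]
    calc p.Lmax * p.P₁ / p.γ = p.Lmax ^ 2 * p.P₁ * 1 ^ 2 * (p.ε ^ 2 / p.Lmax) /
          (p.γ * p.ε ^ 2) := by field_simp
      _ ≤ _ := by
        gcongr
        · exact le_self_pow₀ (by linarith [hp.two_le_P₁]) (by norm_num)
        · exact hp.one_le_P₂
  calc p.tth = 6 / p.c ^ 2 * (p.Lmax * p.P₁ / p.γ * p.logFactor) := by
        rw [tth, hχ]; field_simp
    _ ≤ _ := by
        have h10 : 0 ≤ p.rate := le_trans (by positivity) hrate
        have : p.logFactor ≤ p.logFactor ^ 7 := le_self_pow₀ (by linarith) (by norm_num)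
        gcongr

end Admissible

end PAGDParams

section

variable {d : ℕ} {blk : Fin d → Fin 2} {f : EuclideanSpace ℝ (Fin d) → ℝ} {Lb Lt : Fin 2 → ℝ}

theorem continuous_agdHalf (hg : Continuous (gradient f)) (η : ℝ) :
    Continuous (agdHalf blk f η) := by
  have h1 : agdHalf blk f η = fun x => x - η • blockProj blk 0 (gradient f x) := rfl
  rw [h1]; fun_prop

theorem continuous_agdStep (hg : Continuous (gradient f)) (η : ℝ) :
    Continuous (agdStep blk f η) := by
  have h1 : agdStep blk f η = fun x =>
    agdHalf blk f η x - η • blockProj blk 1 (gradient f (agdHalf blk f η x)) := rfl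
  have h2 := continuous_agdHalf (blk := blk) hg η
  rw [h1]; fun_prop

theorem continuous_agdGradSq (hg : Continuous (gradient f)) (η : ℝ) :
    Continuous (agdGradSq blk f η) := by
  have h1 : agdGradSq blk f η = fun x =>
    ‖blockProj blk 0 (gradient f x)‖ ^ 2 +
      ‖blockProj blk 1 (gradient f (agdHalf blk f η x))‖ ^ 2 := rfl
  have h2 := continuous_agdHalf (blk := blk) hg η
  rw [h1]; fun_prop

/-- Near a strict saddle, few perturbations fail to produce a decrease by `fth`. -/
theorem uniformBall_stuck_le {p : PAGDParams} (hp : p.Admissible) (hpd : p.d = d)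
    (hpL : p.Lmax = blockLmax Lb Lt) (h : IsBlockSmooth blk f Lb Lt)
    (hH : IsHessianLipschitz f p.ρ) (hΔ : p.fth ≤ p.Δ) {m : ℕ} (hm : 0 < m)
    (hm' : (m : ℝ) ≤ 7 * p.Δ / (p.fth * p.δ)) {x v : EuclideanSpace ℝ (Fin d)}
    (hx : agdGradSq blk f p.η x ≤ p.gth ^ 2) (hv : ‖v‖ = 1)
    (hvH : ⟪v, hessian f x v⟫ ≤ -p.γ) :
    uniformBall d p.r {y | -p.fth < f ((agdStep blk f p.η)^[⌈p.tth⌉₊] (x + y)) - f x} ≤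
      ENNReal.ofReal (3 / m) := by
  obtain ⟨hη, hr, hg, hf, -⟩ := hp.pos_derived
  have hηL : p.η * blockLmax Lb Lt ≤ 1 / 16 := by
    rw [← hpL, hp.η_mul_Lmax]; linarith [hp.c_le]
  have hL : 0 ≤ blockLmax Lb Lt := by rw [← hpL]; exact hp.Lmax_pos.le
  have hsmall := hp.linearization_error_le
  rw [hpL] at hsmall
  obtain ⟨φ, hφ, hthin⟩ := exists_escape_direction h hH hp.ρ_pos.le hη hL hηL hr hg.le
    hp.gth_mul_r hp.sq_r hp.le_ceil_tth hsmall hx hp.γ_pos hv hvH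
  have hmeas : MeasurableSet
      {y | -p.fth < f ((agdStep blk f p.η)^[⌈p.tth⌉₊] (x + y)) - f x} := by
    refine (isOpen_lt continuous_const ?_).measurableSet
    have h1 := (continuous_agdStep (blk := blk) hH.2.1.continuous p.η).iterate ⌈p.tth⌉₊
    have h2 := h.1.continuous
    fun_prop
  refine uniformBall_le_of_thin (hpd ▸ hp.d_pos) hr hm hmeas hφ fun u s hs hu hus hu' hus' => ?_
  have h1 := hthin (x + u) s hs (by simpa using hu) (by simpa [add_assoc] using hus) hu'
    (by simpa only [add_assoc, Set.mem_ofPred_eq] using hus')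
  have h2 := hp.growth_gt hΔ hm hm'
  rw [hpd] at h2
  have h3 : 0 < 1 + p.η * p.γ / 2 := by have := hp.γ_pos; positivity
  exact lt_of_mul_lt_mul_left (h1.trans_lt h2) (by positivity)

theorem fth_le_of_saddle {p : PAGDParams} (hp : p.Admissible)
    (hH : IsHessianLipschitz f p.ρ) {fstar : ℝ} (hfs : ∀ y, fstar ≤ f y)
    {x v : EuclideanSpace ℝ (Fin d)} (hx : f x - fstar ≤ p.Δ) (hv : ‖v‖ = 1)
    (hvH : ⟪v, hessian f x v⟫ ≤ -p.γ) : p.fth ≤ p.Δ := by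
  obtain ⟨h1, h2, h3, h4, h5, h6, h7, h8, h9⟩ := hp.pos_all
  obtain ⟨y, hy⟩ := hH.exists_le_sub h3 h6 hv hvH
  refine hp.fth_le.trans (le_trans ?_ (by linarith [hfs y] : p.γ ^ 3 / (16 * p.ρ ^ 2) ≤ p.Δ))
  rw [hp.γ_cube, div_le_div_iff₀ (by positivity) (by positivity)]
  have h10 := hp.ε_le
  rw [le_div_iff₀ h3] at h10
  calc p.ε ^ 2 * (16 * p.ρ ^ 2) = 16 * (p.ε * p.ρ) * (p.ε * p.ρ) := by ring
    _ ≤ 16 * (p.ε * p.ρ) * p.Lmax ^ 2 := by gcongr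
    _ = _ := by ring

/-! ### The run for a fixed noise sequence -/

/-- Iteration `t` starts at `x` and perturbs it. -/
def PerturbsAt (p : PAGDParams) (blk : Fin d → Fin 2) (f : EuclideanSpace ℝ (Fin d) → ℝ)
    (x₀ : EuclideanSpace ℝ (Fin d)) (ξ : ℕ → EuclideanSpace ℝ (Fin d)) (t : ℕ)
    (x : EuclideanSpace ℝ (Fin d)) : Prop :=
  ∃ s, pagdRun p blk f x₀ ξ t = Sum.inl s ∧ s.x = x ∧ agdGradSq blk f p.η x ≤ p.gth ^ 2 ∧
    ∀ q ∈ s.last, q.1 + ⌈p.tth⌉₊ < t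

open Classical in
/-- The number of perturbations before iteration `t`. -/
noncomputable def perturbCount (p : PAGDParams) (blk : Fin d → Fin 2)
    (f : EuclideanSpace ℝ (Fin d) → ℝ) (x₀ : EuclideanSpace ℝ (Fin d))
    (ξ : ℕ → EuclideanSpace ℝ (Fin d)) (t : ℕ) : ℕ :=
  ∑ i ∈ Finset.range t, if ∃ x, PerturbsAt p blk f x₀ ξ i x then 1 else 0

/-- The progress made when the run is in state `s` at the beginning of iteration `t`. -/
structure RunInvariant (p : PAGDParams) (blk : Fin d → Fin 2)
    (f : EuclideanSpace ℝ (Fin d) → ℝ) (x₀ : EuclideanSpace ℝ (Fin d))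
    (ξ : ℕ → EuclideanSpace ℝ (Fin d)) (t : ℕ) (s : PAGDState d) : Prop where
  of_none : s.last = none → perturbCount p blk f x₀ ξ t = 0 ∧
    f s.x ≤ f x₀ - p.fth / (⌈p.tth⌉₊ + 1) * t
  of_some : ∀ tp xt, s.last = some (tp, xt) → PerturbsAt p blk f x₀ ξ tp xt ∧
    ((perturbCount p blk f x₀ ξ t : ℝ) - 1) * (⌈p.tth⌉₊ + 1) ≤ tp ∧
    f xt ≤ f x₀ - p.fth / (⌈p.tth⌉₊ + 1) * tp ∧
    (t ≤ tp + ⌈p.tth⌉₊ → tp ≤ t ∧ s.x = (agdStep blk f p.η)^[t - tp] (xt + ξ tp)) ∧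
    (tp + ⌈p.tth⌉₊ < t → f s.x ≤ f x₀ - p.fth / (⌈p.tth⌉₊ + 1) * t)

variable {p : PAGDParams} {x₀ : EuclideanSpace ℝ (Fin d)} {ξ : ℕ → EuclideanSpace ℝ (Fin d)}

theorem pagdRun_succ_eq_inl {t : ℕ} {s' : PAGDState d}
    (h : pagdRun p blk f x₀ ξ (t + 1) = Sum.inl s') :
    ∃ s, pagdRun p blk f x₀ ξ t = Sum.inl s ∧ pagdIter p blk f t (ξ t) s = Sum.inl s' := by
  rw [pagdRun] at h
  cases hr : pagdRun p blk f x₀ ξ t with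
  | inl s => rw [hr] at h; exact ⟨s, rfl, h⟩
  | inr y => rw [hr] at h; simp at h

theorem RunInvariant.of_perturb {t : ℕ} {s : PAGDState d}
    (hI : RunInvariant p blk f x₀ ξ t s) (hs : ∀ q ∈ s.last, q.1 + ⌈p.tth⌉₊ < t) :
    (perturbCount p blk f x₀ ξ t : ℝ) * (⌈p.tth⌉₊ + 1) ≤ t ∧
      f s.x ≤ f x₀ - p.fth / (⌈p.tth⌉₊ + 1) * t := by
  cases hl : s.last with
  | none =>
    obtain ⟨h1, h2⟩ := hI.of_none hl
    exact ⟨by rw [h1]; simp, h2⟩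
  | some q =>
    obtain ⟨-, h1, -, -, h2⟩ := hI.of_some q.1 q.2 hl
    have h3 := hs q (by rw [hl]; rfl)
    refine ⟨?_, h2 h3⟩
    have : (q.1 : ℝ) + ⌈p.tth⌉₊ + 1 ≤ t := by exact_mod_cast h3
    linarith

theorem perturbCount_succ_of {t : ℕ} (h : ∃ x, PerturbsAt p blk f x₀ ξ t x) :
    perturbCount p blk f x₀ ξ (t + 1) = perturbCount p blk f x₀ ξ t + 1 := by
  rw [perturbCount, Finset.sum_range_succ, if_pos h, ← perturbCount]

theorem perturbCount_succ_of_not {t : ℕ} (h : ¬ ∃ x, PerturbsAt p blk f x₀ ξ t x) :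
    perturbCount p blk f x₀ ξ (t + 1) = perturbCount p blk f x₀ ξ t := by
  rw [perturbCount, Finset.sum_range_succ, if_neg h, ← perturbCount, add_zero]

theorem pagdPerturb_of {t : ℕ} {s : PAGDState d} (y : EuclideanSpace ℝ (Fin d))
    (h : agdGradSq blk f p.η s.x ≤ p.gth ^ 2 ∧ ∀ q ∈ s.last, q.1 + ⌈p.tth⌉₊ < t) :
    pagdPerturb p blk f t y s = ⟨s.x + y, some (t, s.x)⟩ := if_pos h

theorem pagdPerturb_of_not {t : ℕ} {s : PAGDState d} (y : EuclideanSpace ℝ (Fin d))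
    (h : ¬ (agdGradSq blk f p.η s.x ≤ p.gth ^ 2 ∧ ∀ q ∈ s.last, q.1 + ⌈p.tth⌉₊ < t)) :
    pagdPerturb p blk f t y s = s := if_neg h

theorem pagdIter_of_none {t : ℕ} {s : PAGDState d} {y : EuclideanSpace ℝ (Fin d)}
    (h : (pagdPerturb p blk f t y s).last = none) :
    pagdIter p blk f t y s =
      Sum.inl ⟨agdStep blk f p.η (pagdPerturb p blk f t y s).x, none⟩ := by
  unfold pagdIter; split
  · next h' => rw [h] at h'; simp at h'
  · rfl

open Classical in
theorem pagdIter_of_some {t tp : ℕ} {s : PAGDState d} {y xt : EuclideanSpace ℝ (Fin d)}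
    (h : (pagdPerturb p blk f t y s).last = some (tp, xt)) :
    pagdIter p blk f t y s =
      if t = tp + ⌈p.tth⌉₊ ∧ -p.fth < f (pagdPerturb p blk f t y s).x - f xt then Sum.inr xt
      else Sum.inl ⟨agdStep blk f p.η (pagdPerturb p blk f t y s).x, some (tp, xt)⟩ := by
  unfold pagdIter; split
  · next h' => rw [h] at h'; cases h'; rfl
  · next h' => rw [h] at h'; simp at h'

theorem not_exists_perturbsAt {t : ℕ} {s : PAGDState d}
    (hs : pagdRun p blk f x₀ ξ t = Sum.inl s)
    (h : ¬ (agdGradSq blk f p.η s.x ≤ p.gth ^ 2 ∧ ∀ q ∈ s.last, q.1 + ⌈p.tth⌉₊ < t)) :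
    ¬ ∃ x, PerturbsAt p blk f x₀ ξ t x := by
  rintro ⟨x, s', hs', rfl, h1⟩
  rw [hs] at hs'; cases hs'
  exact h h1

theorem runInvariant_succ (hfth : 0 < p.fth) (hη : 0 ≤ p.η) (hK : 0 < ⌈p.tth⌉₊)
    (hηg : p.η * p.gth ^ 2 = p.fth)
    (hdec : ∀ x, f (agdStep blk f p.η x) ≤ f x - p.η / 2 * agdGradSq blk f p.η x)
    {t : ℕ} {s s' : PAGDState d} (hs : pagdRun p blk f x₀ ξ t = Sum.inl s)
    (hit : pagdIter p blk f t (ξ t) s = Sum.inl s') (hI : RunInvariant p blk f x₀ ξ t s) :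
    RunInvariant p blk f x₀ ξ (t + 1) s' := by
  have hK1 : (1 : ℝ) ≤ ⌈p.tth⌉₊ := by exact_mod_cast hK
  have ha : p.fth / (⌈p.tth⌉₊ + 1) ≤ p.fth / 2 := by gcongr; linarith
  have hdec' : ∀ x, f (agdStep blk f p.η x) ≤ f x := fun x => by
    have : 0 ≤ agdGradSq blk f p.η x := by rw [agdGradSq]; positivity
    have := mul_nonneg hη this
    linarith [hdec x]
  have hbig : ∀ x, ¬ agdGradSq blk f p.η x ≤ p.gth ^ 2 →
      f (agdStep blk f p.η x) ≤ f x - p.fth / (⌈p.tth⌉₊ + 1) := fun x hx => by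
    have := mul_le_mul_of_nonneg_left (not_le.1 hx).le hη
    linarith [hdec x]
  by_cases hpert : agdGradSq blk f p.η s.x ≤ p.gth ^ 2 ∧ ∀ q ∈ s.last, q.1 + ⌈p.tth⌉₊ < t
  · have hP : PerturbsAt p blk f x₀ ξ t s.x := ⟨s, hs, rfl, hpert⟩
    obtain ⟨h1, h2⟩ := hI.of_perturb hpert.2
    rw [pagdIter_of_some (by rw [pagdPerturb_of _ hpert]), if_neg (by omega),
      pagdPerturb_of _ hpert] at hit
    cases hit
    refine ⟨fun h => by simp at h, fun tp xt h => ?_⟩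
    cases h
    refine ⟨hP, ?_, h2, fun _ => ⟨by omega, by simp⟩, fun h => by omega⟩
    rw [perturbCount_succ_of ⟨_, hP⟩]
    push_cast
    linarith
  · have hcount := perturbCount_succ_of_not (not_exists_perturbsAt hs hpert)
    have hpp := pagdPerturb_of_not (ξ t) hpert
    cases hl : s.last with
    | none =>
      rw [pagdIter_of_none (by rw [hpp, hl]), hpp] at hit
      cases hit
      obtain ⟨h1, h2⟩ := hI.of_none hl
      refine ⟨fun _ => ⟨by rw [hcount, h1], ?_⟩, fun tp xt h => by simp at h⟩
      have h3 : ¬ agdGradSq blk f p.η s.x ≤ p.gth ^ 2 := fun h => hpert ⟨h, by simp [hl]⟩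
      have := hbig _ h3
      push_cast
      linarith
    | some q =>
      obtain ⟨tp, xt⟩ := q
      obtain ⟨hP, h1, h2, h3, h4⟩ := hI.of_some tp xt hl
      rw [pagdIter_of_some (by rw [hpp, hl]), hpp] at hit
      split_ifs at hit with htest
      cases hit
      refine ⟨fun h => by simp at h, fun tp' xt' h => ?_⟩
      cases h
      refine ⟨hP, by rw [hcount]; exact h1, h2, fun h => ?_, fun h => ?_⟩
      · obtain ⟨h5, h6⟩ := h3 (by omega)
        refine ⟨by omega, ?_⟩
        rw [Nat.sub_add_comm h5, Function.iterate_succ_apply', ← h6]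
      · push_cast
        rcases Nat.lt_or_ge (tp + ⌈p.tth⌉₊) t with ht | ht
        · have h5 : ¬ agdGradSq blk f p.η s.x ≤ p.gth ^ 2 := fun h =>
            hpert ⟨h, by simpa [hl] using ht⟩
          have := hbig _ h5
          have := h4 ht
          linarith
        · have ht' : t = tp + ⌈p.tth⌉₊ := by omega
          have h5 : f s.x - f xt ≤ -p.fth := not_lt.1 fun h => htest ⟨ht', h⟩
          have h6 := hdec' s.x
          have h7 : p.fth / (⌈p.tth⌉₊ + 1) * ((⌈p.tth⌉₊ : ℝ) + 1) = p.fth := by field_simp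
          have h8 : (t : ℝ) = tp + ⌈p.tth⌉₊ := by exact_mod_cast ht'
          rw [h8]
          linarith

/-- Parameters and objective for which the run makes progress. -/
structure RunRegular (p : PAGDParams) (blk : Fin d → Fin 2)
    (f : EuclideanSpace ℝ (Fin d) → ℝ) : Prop where
  fth_pos : 0 < p.fth
  η_nonneg : 0 ≤ p.η
  K_pos : 0 < ⌈p.tth⌉₊
  η_mul : p.η * p.gth ^ 2 = p.fth
  decrease : ∀ x, f (agdStep blk f p.η x) ≤ f x - p.η / 2 * agdGradSq blk f p.η x

theorem RunRegular.invariant (hR : RunRegular p blk f) {t : ℕ} :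
    ∀ {s : PAGDState d}, pagdRun p blk f x₀ ξ t = Sum.inl s → RunInvariant p blk f x₀ ξ t s := by
  induction t with
  | zero =>
    intro s h
    rw [pagdRun] at h
    cases h
    exact ⟨fun _ => ⟨by simp [perturbCount], by simp⟩, fun _ _ h => by simp at h⟩
  | succ t ih =>
    intro s' h
    obtain ⟨s, hs, hit⟩ := pagdRun_succ_eq_inl h
    exact runInvariant_succ hR.fth_pos hR.η_nonneg hR.K_pos hR.η_mul hR.decrease hs hit (ih hs)

theorem RunRegular.of_perturbsAt (hR : RunRegular p blk f) {t : ℕ} {x : EuclideanSpace ℝ (Fin d)}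
    (h : PerturbsAt p blk f x₀ ξ t x) :
    (perturbCount p blk f x₀ ξ t : ℝ) * (⌈p.tth⌉₊ + 1) ≤ t ∧
      f x ≤ f x₀ - p.fth / (⌈p.tth⌉₊ + 1) * t := by
  obtain ⟨s, hs, rfl, -, h1⟩ := h
  exact (hR.invariant hs).of_perturb h1

theorem RunRegular.perturbCount_le (hR : RunRegular p blk f) {fstar : ℝ}
    (hfs : ∀ y, fstar ≤ f y) (t : ℕ) :
    (perturbCount p blk f x₀ ξ t : ℝ) ≤ (f x₀ - fstar) / p.fth + 1 := by
  have hf := hR.fth_pos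
  have h0 : 0 ≤ (f x₀ - fstar) / p.fth := div_nonneg (by linarith [hfs x₀]) hf.le
  induction t with
  | zero => simp only [perturbCount, Finset.range_zero, Finset.sum_empty, Nat.cast_zero]; linarith
  | succ t ih =>
    by_cases h : ∃ x, PerturbsAt p blk f x₀ ξ t x
    · rw [perturbCount_succ_of h]
      obtain ⟨x, hx⟩ := h
      obtain ⟨h1, h2⟩ := hR.of_perturbsAt hx
      have h3 : p.fth / (⌈p.tth⌉₊ + 1) * t ≤ f x₀ - fstar := by linarith [hfs x]
      push_cast
      gcongr
      rw [le_div_iff₀ hf]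
      refine le_trans ?_ h3
      rw [div_mul_eq_mul_div, le_div_iff₀ (by positivity)]
      nlinarith
    · rw [perturbCount_succ_of_not h]; exact ih

theorem RunRegular.time_le (hR : RunRegular p blk f) {fstar : ℝ}
    (hfs : ∀ y, fstar ≤ f y) {t : ℕ} {s : PAGDState d}
    (hs : pagdRun p blk f x₀ ξ t = Sum.inl s) :
    (t : ℝ) + 1 ≤ (⌈p.tth⌉₊ + 1) * ((f x₀ - fstar) / p.fth + 1) := by
  have hf := hR.fth_pos
  have hI := hR.invariant hs
  have key : ∀ (u : ℕ) (y : EuclideanSpace ℝ (Fin d)),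
      f y ≤ f x₀ - p.fth / (⌈p.tth⌉₊ + 1) * u →
      (u : ℝ) ≤ (⌈p.tth⌉₊ + 1) * ((f x₀ - fstar) / p.fth) := fun u y hy => by
    have h3 : p.fth / (⌈p.tth⌉₊ + 1) * u ≤ f x₀ - fstar := by linarith [hfs y]
    calc (u : ℝ) = (⌈p.tth⌉₊ + 1) * ((p.fth / (⌈p.tth⌉₊ + 1) * u) / p.fth) := by field_simp
      _ ≤ _ := by gcongr
  have hK : (0 : ℝ) ≤ ⌈p.tth⌉₊ := by positivity
  cases hl : s.last with
  | none =>
    have := key _ _ (hI.of_none hl).2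
    linarith
  | some q =>
    obtain ⟨-, -, h2, -, h4⟩ := hI.of_some q.1 q.2 hl
    rcases Nat.lt_or_ge (q.1 + ⌈p.tth⌉₊) t with ht | ht
    · have := key _ _ (h4 ht)
      linarith
    · have := key _ _ h2
      have h5 : (t : ℝ) ≤ q.1 + ⌈p.tth⌉₊ := by exact_mod_cast ht
      linarith

theorem RunRegular.exists_return (hR : RunRegular p blk f) {fstar : ℝ} (hfs : ∀ y, fstar ≤ f y)
    (x₀ : EuclideanSpace ℝ (Fin d)) (ξ : ℕ → EuclideanSpace ℝ (Fin d)) :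
    ∃ (T tp : ℕ) (x : EuclideanSpace ℝ (Fin d)), pagdRun p blk f x₀ ξ T = Sum.inr x ∧
      (T : ℝ) ≤ (⌈p.tth⌉₊ + 1) * ((f x₀ - fstar) / p.fth + 1) ∧ tp < T ∧
      PerturbsAt p blk f x₀ ξ tp x ∧
      -p.fth < f ((agdStep blk f p.η)^[⌈p.tth⌉₊] (x + ξ tp)) - f x := by
  have hex : ∃ T, ∀ s, pagdRun p blk f x₀ ξ T ≠ Sum.inl s := by
    refine ⟨⌈(⌈p.tth⌉₊ + 1) * ((f x₀ - fstar) / p.fth + 1)⌉₊, fun s hs => ?_⟩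
    have h1 := hR.time_le hfs hs
    have h2 := Nat.le_ceil ((⌈p.tth⌉₊ + 1) * ((f x₀ - fstar) / p.fth + 1))
    linarith
  classical
  obtain ⟨t, ht⟩ : ∃ t, Nat.find hex = t + 1 := by
    refine Nat.exists_eq_succ_of_ne_zero fun h0 => ?_
    have := Nat.find_spec hex
    rw [h0] at this
    exact this _ rfl
  have hspec := Nat.find_spec hex
  have hmin := Nat.find_min hex (m := t) (by omega)
  push Not at hmin
  obtain ⟨s, hs⟩ := hmin
  rw [ht, pagdRun, hs] at hspec
  simp only at hspec
  have hI := hR.invariant hs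
  have hK := hR.K_pos
  by_cases hpert : agdGradSq blk f p.η s.x ≤ p.gth ^ 2 ∧ ∀ q ∈ s.last, q.1 + ⌈p.tth⌉₊ < t
  · rw [pagdIter_of_some (by rw [pagdPerturb_of _ hpert]), if_neg (by omega)] at hspec
    exact absurd rfl (hspec _)
  have hpp := pagdPerturb_of_not (ξ t) hpert
  cases hl : s.last with
  | none =>
    rw [pagdIter_of_none (by rw [hpp, hl])] at hspec
    exact absurd rfl (hspec _)
  | some q =>
    obtain ⟨tp, xt⟩ := q
    obtain ⟨hP, -, -, h3, -⟩ := hI.of_some tp xt hl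
    have hit := pagdIter_of_some (p := p) (blk := blk) (f := f) (y := ξ t) (s := s) (t := t)
      (tp := tp) (xt := xt) (by rw [hpp, hl])
    rw [hpp] at hit
    split_ifs at hit with htest
    · refine ⟨t + 1, tp, xt, by rw [pagdRun, hs]; exact hit, ?_, by omega, hP, ?_⟩
      · push_cast; exact hR.time_le hfs hs
      · obtain ⟨-, h5⟩ := h3 htest.1.le
        have h6 : t - tp = ⌈p.tth⌉₊ := by omega
        rw [← h6, ← h5]
        exact htest.2
    · rw [hit] at hspec
      exact absurd rfl (hspec _)

end

theorem measure_setOf_mem_and_le {Ω S E : Type*} [MeasurableSpace Ω] [MeasurableSpace S]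
    [MeasurableSpace E] {P : Measure Ω} [IsProbabilityMeasure P] {ν : Measure E}
    {Y : Ω → S} {X : Ω → E} (hY : Measurable Y) (hX : Measurable X) (hind : IndepFun Y X P)
    (hν : P.map X = ν) {D : Set S} (hD : MeasurableSet D) {B : Set (S × E)} (hB : MeasurableSet B)
    {c : ENNReal} (h : ∀ s ∈ D, ν (Prod.mk s ⁻¹' B) ≤ c) :
    P {ω | Y ω ∈ D ∧ (Y ω, X ω) ∈ B} ≤ c * P {ω | Y ω ∈ D} := by
  have hprod := (indepFun_iff_map_prod_eq_prod_map_map hY.aemeasurable hX.aemeasurable).1 hind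
  rw [hν] at hprod
  have : IsProbabilityMeasure ν := hν ▸ Measure.isProbabilityMeasure_map hX.aemeasurable
  have hmeas : MeasurableSet ((D ×ˢ Set.univ) ∩ B) := (hD.prod MeasurableSet.univ).inter hB
  calc P {ω | Y ω ∈ D ∧ (Y ω, X ω) ∈ B}
      = (P.map fun ω => (Y ω, X ω)) ((D ×ˢ Set.univ) ∩ B) := by
        rw [Measure.map_apply (hY.prodMk hX) hmeas]
        congr 1; ext ω; simp
    _ = ∫⁻ s, ν (Prod.mk s ⁻¹' ((D ×ˢ Set.univ) ∩ B)) ∂(P.map Y) := by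
        rw [hprod, Measure.prod_apply hmeas]
    _ ≤ ∫⁻ s, D.indicator (fun _ => c) s ∂(P.map Y) := by
        refine lintegral_mono fun s => ?_
        by_cases hs : s ∈ D
        · rw [Set.indicator_of_mem hs]
          exact (measure_mono fun y hy => hy.2).trans (h s hs)
        · have : Prod.mk s ⁻¹' ((D ×ˢ Set.univ) ∩ B) = ∅ := by ext y; simp [hs]
          rw [this]; simp
    _ = c * P {ω | Y ω ∈ D} := by
        rw [lintegral_indicator_const hD, Measure.map_apply hY hD]; rfl

section

variable {d : ℕ} {p : PAGDParams} {blk : Fin d → Fin 2} {f : EuclideanSpace ℝ (Fin d) → ℝ}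
  {x₀ : EuclideanSpace ℝ (Fin d)}

/-- The states of the algorithm, encoded in a measurable space: the middle component is `0` before
the first perturbation, `1` after the return and `tp + 2` if the last perturbation was at `tp`. -/
def runCode : PAGDState d ⊕ EuclideanSpace ℝ (Fin d) →
    EuclideanSpace ℝ (Fin d) × ℕ × EuclideanSpace ℝ (Fin d)
  | Sum.inl ⟨x, none⟩ => (x, 0, 0)
  | Sum.inl ⟨x, some (tp, y)⟩ => (x, tp + 2, y)
  | Sum.inr y => (0, 1, y)

/-- The codes of the states that are perturbed in iteration `t`. -/
def perturbCodes (p : PAGDParams) (blk : Fin d → Fin 2) (f : EuclideanSpace ℝ (Fin d) → ℝ)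
    (t : ℕ) : Set (EuclideanSpace ℝ (Fin d) × ℕ × EuclideanSpace ℝ (Fin d)) :=
  {c | agdGradSq blk f p.η c.1 ≤ p.gth ^ 2 ∧
    c.2.1 ∈ {n : ℕ | n ≠ 1 ∧ (n = 0 ∨ n - 2 + ⌈p.tth⌉₊ < t)}}

/-- The codes of the states in which iteration `t` returns. -/
def returnCodes (p : PAGDParams) (f : EuclideanSpace ℝ (Fin d) → ℝ)
    (t : ℕ) : Set (EuclideanSpace ℝ (Fin d) × ℕ × EuclideanSpace ℝ (Fin d)) :=
  {c | c.2.1 ∈ {n : ℕ | 2 ≤ n ∧ t = n - 2 + ⌈p.tth⌉₊} ∧ -p.fth < f c.1 - f c.2.2}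

open Classical in
/-- One iteration on the level of codes. -/
noncomputable def iterCode (p : PAGDParams) (blk : Fin d → Fin 2)
    (f : EuclideanSpace ℝ (Fin d) → ℝ) (t : ℕ)
    (a : (EuclideanSpace ℝ (Fin d) × ℕ × EuclideanSpace ℝ (Fin d)) × EuclideanSpace ℝ (Fin d)) :
    EuclideanSpace ℝ (Fin d) × ℕ × EuclideanSpace ℝ (Fin d) :=
  if a.1 ∈ perturbCodes p blk f t then (agdStep blk f p.η (a.1.1 + a.2), t + 2, a.1.1)
  else if a.1.2.1 ∈ ({1} : Set ℕ) then a.1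
  else if a.1 ∈ returnCodes p f t then (0, 1, a.1.2.2)
  else (agdStep blk f p.η a.1.1, a.1.2)

theorem measurableSet_perturbCodes (hg : Continuous (gradient f)) (t : ℕ) :
    MeasurableSet (perturbCodes p blk f t) := by
  have h1 := (continuous_agdGradSq (blk := blk) hg p.η).measurable
  have h2 : MeasurableSet {c : EuclideanSpace ℝ (Fin d) × ℕ × EuclideanSpace ℝ (Fin d) |
      agdGradSq blk f p.η c.1 ≤ p.gth ^ 2} :=
    measurableSet_le (h1.comp measurable_fst) measurable_const
  have h3 : MeasurableSet {c : EuclideanSpace ℝ (Fin d) × ℕ × EuclideanSpace ℝ (Fin d) |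
      c.2.1 ∈ {n : ℕ | n ≠ 1 ∧ (n = 0 ∨ n - 2 + ⌈p.tth⌉₊ < t)}} :=
    (measurable_fst.comp measurable_snd) MeasurableSet.of_discrete
  exact h2.inter h3

theorem measurableSet_returnCodes (hf : Continuous f) (t : ℕ) :
    MeasurableSet (returnCodes p f t) := by
  have h1 := hf.measurable
  have h2 : MeasurableSet {c : EuclideanSpace ℝ (Fin d) × ℕ × EuclideanSpace ℝ (Fin d) |
      c.2.1 ∈ {n : ℕ | 2 ≤ n ∧ t = n - 2 + ⌈p.tth⌉₊}} :=
    (measurable_fst.comp measurable_snd) MeasurableSet.of_discrete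
  have h3 : MeasurableSet {c : EuclideanSpace ℝ (Fin d) × ℕ × EuclideanSpace ℝ (Fin d) |
      -p.fth < f c.1 - f c.2.2} :=
    measurableSet_lt measurable_const ((h1.comp measurable_fst).sub (h1.comp measurable_snd.snd))
  exact h2.inter h3

theorem measurable_iterCode (hf : Continuous f) (hg : Continuous (gradient f)) (t : ℕ) :
    Measurable (iterCode p blk f t) := by
  have h1 := (continuous_agdStep (blk := blk) hg p.η).measurable
  refine Measurable.ite (measurable_fst (measurableSet_perturbCodes hg t)) ?_
    (Measurable.ite (measurable_fst.snd.fst (MeasurableSet.of_discrete)) measurable_fst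
      (Measurable.ite (measurable_fst (measurableSet_returnCodes hf t)) ?_ ?_))
  · fun_prop
  · fun_prop
  · fun_prop

theorem runCode_succ (hK : 0 < ⌈p.tth⌉₊) (ξ : ℕ → EuclideanSpace ℝ (Fin d)) (t : ℕ) :
    runCode (pagdRun p blk f x₀ ξ (t + 1)) =
      iterCode p blk f t (runCode (pagdRun p blk f x₀ ξ t), ξ t) := by
  rw [pagdRun]
  rcases pagdRun p blk f x₀ ξ t with ⟨x, _ | ⟨tp, xt⟩⟩ | y
  · by_cases hpert : agdGradSq blk f p.η x ≤ p.gth ^ 2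
    · have h1 := pagdPerturb_of (p := p) (blk := blk) (f := f) (t := t) (s := ⟨x, none⟩) (ξ t)
        ⟨hpert, by simp⟩
      simp only
      rw [pagdIter_of_some (by rw [h1]), if_neg (by omega), h1]
      simp [runCode, iterCode, perturbCodes, hpert]
    · have h1 := pagdPerturb_of_not (p := p) (blk := blk) (f := f) (t := t) (s := ⟨x, none⟩) (ξ t)
        (fun h => hpert h.1)
      simp only
      rw [pagdIter_of_none (by rw [h1]), h1]
      simp [runCode, iterCode, perturbCodes, returnCodes, hpert]
  · by_cases hpert : agdGradSq blk f p.η x ≤ p.gth ^ 2 ∧ tp + ⌈p.tth⌉₊ < t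
    · have h1 := pagdPerturb_of (p := p) (blk := blk) (f := f) (t := t) (s := ⟨x, some (tp, xt)⟩)
        (ξ t) ⟨hpert.1, by simpa using hpert.2⟩
      simp only
      rw [pagdIter_of_some (by rw [h1]), if_neg (by omega), h1]
      simp [runCode, iterCode, perturbCodes, hpert]
    · have h1 := pagdPerturb_of_not (p := p) (blk := blk) (f := f) (t := t)
        (s := ⟨x, some (tp, xt)⟩) (ξ t) (fun h => hpert ⟨h.1, by simpa using h.2⟩)
      simp only
      rw [pagdIter_of_some (by rw [h1]), h1]
      have h2 : ((x, tp + 2, xt) : _ × ℕ × _) ∉ perturbCodes p blk f t := fun h =>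
        hpert ⟨h.1, by simpa using h.2.2⟩
      by_cases htest : t = tp + ⌈p.tth⌉₊ ∧ -p.fth < f x - f xt
      · rw [if_pos htest]
        have h3 : ((x, tp + 2, xt) : _ × ℕ × _) ∈ returnCodes p f t :=
          ⟨⟨by simp, by simpa using htest.1⟩, htest.2⟩
        simp [runCode, iterCode, h2, h3]
      · rw [if_neg htest]
        have h3 : ((x, tp + 2, xt) : _ × ℕ × _) ∉ returnCodes p f t := fun h =>
          htest ⟨by simpa using h.1.2, h.2⟩
        simp [runCode, iterCode, h2, h3]
  · simp [runCode, iterCode, perturbCodes]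

theorem measurable_runCode (hf : Continuous f) (hg : Continuous (gradient f))
    (hK : 0 < ⌈p.tth⌉₊) {Ω : Type*} [MeasurableSpace Ω] {ξ : ℕ → Ω → EuclideanSpace ℝ (Fin d)}
    (hξ : ∀ t, Measurable (ξ t)) (t : ℕ) :
    Measurable fun ω => runCode (pagdRun p blk f x₀ (fun t => ξ t ω) t) := by
  induction t with
  | zero => exact measurable_const
  | succ t ih =>
    simp only [runCode_succ hK]
    exact (measurable_iterCode hf hg t).comp (ih.prodMk (hξ t))

theorem pagdRun_congr {ξ ξ' : ℕ → EuclideanSpace ℝ (Fin d)} {t : ℕ} (h : ∀ i < t, ξ i = ξ' i) :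
    pagdRun p blk f x₀ ξ t = pagdRun p blk f x₀ ξ' t := by
  induction t with
  | zero => rfl
  | succ t ih => rw [pagdRun, pagdRun, ih fun i hi => h i (by omega), h t (by omega)]

theorem indepFun_runCode (hf : Continuous f) (hg : Continuous (gradient f))
    (hK : 0 < ⌈p.tth⌉₊) {Ω : Type*} [MeasurableSpace Ω] {P : Measure Ω}
    {ξ : ℕ → Ω → EuclideanSpace ℝ (Fin d)} (hξ : ∀ t, Measurable (ξ t)) (hind : iIndepFun ξ P)
    (t : ℕ) :
    IndepFun (fun ω => runCode (pagdRun p blk f x₀ (fun t => ξ t ω) t)) (ξ t) P := by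
  have h1 := hind.indepFun_finset (Finset.range t) {t} (by simp) hξ
  let ζ : ℕ → (Finset.range t → EuclideanSpace ℝ (Fin d)) → EuclideanSpace ℝ (Fin d) :=
    fun i h => if hi : i ∈ Finset.range t then h ⟨i, hi⟩ else 0
  have hζ : ∀ i, Measurable (ζ i) := fun i => by
    by_cases hi : i ∈ Finset.range t
    · simp only [ζ, dif_pos hi]; exact measurable_pi_apply _
    · simp only [ζ, dif_neg hi]; exact measurable_const
  have h2 := h1.comp (measurable_runCode (p := p) (blk := blk) (x₀ := x₀) hf hg hK hζ t)
    (measurable_pi_apply (⟨t, Finset.mem_singleton_self t⟩ : ({t} : Finset ℕ)))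
  refine IndepFun.congr h2 (.of_forall fun ω => ?_) (.of_forall fun ω => rfl)
  simp only [Function.comp_apply]
  rw [pagdRun_congr]
  intro i hi
  simp [ζ, hi]

theorem perturbsAt_iff_runCode {ξ : ℕ → EuclideanSpace ℝ (Fin d)} {t : ℕ}
    {x : EuclideanSpace ℝ (Fin d)} : PerturbsAt p blk f x₀ ξ t x ↔
      runCode (pagdRun p blk f x₀ ξ t) ∈ perturbCodes p blk f t ∧
        (runCode (pagdRun p blk f x₀ ξ t)).1 = x := by
  rw [PerturbsAt]
  rcases pagdRun p blk f x₀ ξ t with ⟨y, _ | ⟨tp, yt⟩⟩ | y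
  · simp [runCode, perturbCodes]; grind
  · simp [runCode, perturbCodes]; grind
  · simp [runCode, perturbCodes]

/-- A union bound over the random times of the perturbations. -/
theorem measure_exists_perturbsAt_le (hR : RunRegular p blk f) (hf : Continuous f)
    (hg : Continuous (gradient f)) {fstar : ℝ} (hfs : ∀ y, fstar ≤ f y) {Ω : Type*}
    [MeasurableSpace Ω] {P : Measure Ω} [IsProbabilityMeasure P]
    {ξ : ℕ → Ω → EuclideanSpace ℝ (Fin d)} (hξ : ∀ t, Measurable (ξ t)) (hind : iIndepFun ξ P)
    {ν : Measure (EuclideanSpace ℝ (Fin d))} (hν : ∀ t, P.map (ξ t) = ν)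
    {B : Set (EuclideanSpace ℝ (Fin d) × EuclideanSpace ℝ (Fin d))} (hB : MeasurableSet B)
    (c : ENNReal) :
    P {ω | ∃ t x, PerturbsAt p blk f x₀ (fun t => ξ t ω) t x ∧ ν (Prod.mk x ⁻¹' B) ≤ c ∧
        (x, ξ t ω) ∈ B} ≤ c * ENNReal.ofReal ((f x₀ - fstar) / p.fth + 1) := by
  have : IsProbabilityMeasure ν := hν 0 ▸ Measure.isProbabilityMeasure_map (hξ 0).aemeasurable
  set Y : ℕ → Ω → _ := fun t ω => runCode (pagdRun p blk f x₀ (fun t => ξ t ω) t) with hY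
  have hYm : ∀ t, Measurable (Y t) := measurable_runCode hf hg hR.K_pos hξ
  have hPm : ∀ t, MeasurableSet {ω | Y t ω ∈ perturbCodes p blk f t} := fun t =>
    hYm t (measurableSet_perturbCodes hg t)
  have hstep : ∀ t, P {ω | Y t ω ∈ perturbCodes p blk f t ∩ {a | ν (Prod.mk a.1 ⁻¹' B) ≤ c} ∧
      (Y t ω, ξ t ω) ∈ {a | (a.1.1, a.2) ∈ B}} ≤ c * P {ω | Y t ω ∈ perturbCodes p blk f t} :=
    fun t => by
      have h1 : MeasurableSet {a : EuclideanSpace ℝ (Fin d) × ℕ × EuclideanSpace ℝ (Fin d) |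
          ν (Prod.mk a.1 ⁻¹' B) ≤ c} :=
        measurableSet_le ((measurable_measure_prodMk_left hB).comp measurable_fst)
          measurable_const
      have h2 : MeasurableSet {a : (EuclideanSpace ℝ (Fin d) × ℕ × EuclideanSpace ℝ (Fin d)) ×
          EuclideanSpace ℝ (Fin d) | (a.1.1, a.2) ∈ B} :=
        (measurable_fst.fst.prodMk measurable_snd) hB
      refine (measure_setOf_mem_and_le (hYm t) (hξ t)
        (indepFun_runCode hf hg hR.K_pos hξ hind t) (hν t)
        ((measurableSet_perturbCodes hg t).inter h1) h2 fun s hs => hs.2).trans ?_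
      gcongr
      exact fun ω hω => hω.1
  calc P {ω | ∃ t x, PerturbsAt p blk f x₀ (fun t => ξ t ω) t x ∧ ν (Prod.mk x ⁻¹' B) ≤ c ∧
        (x, ξ t ω) ∈ B}
      ≤ P (⋃ t, {ω | Y t ω ∈ perturbCodes p blk f t ∩ {a | ν (Prod.mk a.1 ⁻¹' B) ≤ c} ∧
          (Y t ω, ξ t ω) ∈ {a | (a.1.1, a.2) ∈ B}}) := by
        refine measure_mono ?_
        rintro ω ⟨t, x, hx, h1, h2⟩
        obtain ⟨h3, rfl⟩ := perturbsAt_iff_runCode.1 hx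
        exact Set.mem_iUnion.2 ⟨t, ⟨h3, h1⟩, h2⟩
    _ ≤ ∑' t, c * P {ω | Y t ω ∈ perturbCodes p blk f t} :=
        (measure_iUnion_le _).trans (ENNReal.tsum_le_tsum hstep)
    _ = c * ∫⁻ ω, ∑' t, {ω | Y t ω ∈ perturbCodes p blk f t}.indicator 1 ω ∂P := by
        rw [ENNReal.tsum_mul_left, lintegral_tsum fun t =>
          (measurable_one.indicator (hPm t)).aemeasurable]
        simp only [lintegral_indicator_one (hPm _)]
    _ ≤ c * ∫⁻ _, ENNReal.ofReal ((f x₀ - fstar) / p.fth + 1) ∂P := by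
        gcongr with ω
        refine ENNReal.tsum_le_of_sum_range_le fun n => ?_
        have h1 := hR.perturbCount_le (x₀ := x₀) (ξ := fun t => ξ t ω) hfs n
        have h2 : ∑ t ∈ Finset.range n,
            {ω | Y t ω ∈ perturbCodes p blk f t}.indicator (1 : Ω → ENNReal) ω =
            (perturbCount p blk f x₀ (fun t => ξ t ω) n : ENNReal) := by
          rw [perturbCount]
          rw [Nat.cast_sum]
          refine Finset.sum_congr rfl fun t _ => ?_
          have hiff : (∃ x, PerturbsAt p blk f x₀ (fun t => ξ t ω) t x) ↔
              Y t ω ∈ perturbCodes p blk f t :=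
            ⟨fun ⟨_, h⟩ => (perturbsAt_iff_runCode.1 h).1,
              fun h => ⟨_, perturbsAt_iff_runCode.2 ⟨h, rfl⟩⟩⟩
          by_cases h : ω ∈ {ω | Y t ω ∈ perturbCodes p blk f t}
          · rw [if_pos (hiff.2 h), Set.indicator_of_mem h, Pi.one_apply, Nat.cast_one]
          · rw [if_neg (fun h' => h (hiff.1 h')), Set.indicator_of_notMem h, Nat.cast_zero]
        rw [h2, ← ENNReal.ofReal_natCast]
        exact ENNReal.ofReal_le_ofReal h1
    _ = _ := by simp

end

section

variable {d : ℕ} {blk : Fin d → Fin 2} {f : EuclideanSpace ℝ (Fin d) → ℝ} {Lb Lt : Fin 2 → ℝ}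

theorem IsBlockSmooth.runRegular {p : PAGDParams} (hp : p.Admissible)
    (hpL : p.Lmax = blockLmax Lb Lt) (h : IsBlockSmooth blk f Lb Lt) : RunRegular p blk f where
  fth_pos := hp.pos_derived.2.2.2.1
  η_nonneg := hp.pos_derived.1.le
  K_pos := by have := hp.le_ceil_tth; omega
  η_mul := hp.η_mul_sq_gth
  decrease := h.agdStep_le hp.pos_derived.1.le (by
    rw [← hpL, hp.η_mul_Lmax]; linarith [hp.c_le])

/-- The probability that the algorithm returns a point that is not second-order stationary. -/
theorem measure_not_isSS2_le {p : PAGDParams} (hp : p.Admissible) (hpd : p.d = d)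
    (hpL : p.Lmax = blockLmax Lb Lt) (h : IsBlockSmooth blk f Lb Lt)
    (hH : IsHessianLipschitz f p.ρ) {fstar : ℝ} (hfs : ∀ y, fstar ≤ f y)
    {x₀ : EuclideanSpace ℝ (Fin d)} (hpΔ : p.Δ = f x₀ - fstar) {Ω : Type*}
    [MeasurableSpace Ω] {P : Measure Ω} [IsProbabilityMeasure P]
    {ξ : ℕ → Ω → EuclideanSpace ℝ (Fin d)} (hξ : ∀ t, Measurable (ξ t)) (hind : iIndepFun ξ P)
    (hν : ∀ t, P.map (ξ t) = uniformBall d p.r) :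
    P {ω | ∃ t x, PerturbsAt p blk f x₀ (fun t => ξ t ω) t x ∧ ¬ IsSS2 f p.ε p.γ x ∧
        -p.fth < f ((agdStep blk f p.η)^[⌈p.tth⌉₊] (x + ξ t ω)) - f x} ≤ ENNReal.ofReal p.δ := by
  have hR := h.runRegular hp hpL
  have hsaddle : ∀ ξ t x, PerturbsAt p blk f x₀ ξ t x → ¬ IsSS2 f p.ε p.γ x →
      agdGradSq blk f p.η x ≤ p.gth ^ 2 ∧ f x - fstar ≤ p.Δ ∧
        ∃ v, ‖v‖ = 1 ∧ ⟪v, hessian f x v⟫ ≤ -p.γ := fun ξ t x hx hnot => by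
    have h1 : agdGradSq blk f p.η x ≤ p.gth ^ 2 := by
      obtain ⟨s, -, -, h1, -⟩ := hx
      exact h1
    refine ⟨h1, ?_, exists_unit_of_not_isSS2 ?_ hnot⟩
    · have h2 := (hR.of_perturbsAt hx).2
      have h3 := hR.fth_pos
      have : 0 ≤ p.fth / (⌈p.tth⌉₊ + 1) * t := by positivity
      rw [hpΔ]; linarith
    · refine (h.norm_gradient_le hp.pos_derived.1.le ?_ hp.pos_derived.2.2.1.le h1).trans
        hp.two_mul_gth_le
      rw [← hpL, hp.η_mul_Lmax]; linarith [hp.c_le]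
  by_cases hΔ : p.fth ≤ p.Δ
  · obtain ⟨m, hm, hm', hmδ⟩ := hp.exists_translate_count hΔ
    let B : Set (EuclideanSpace ℝ (Fin d) × EuclideanSpace ℝ (Fin d)) :=
      {a | -p.fth < f ((agdStep blk f p.η)^[⌈p.tth⌉₊] (a.1 + a.2)) - f a.1}
    have hf := h.1.continuous
    have hg := hH.2.1.continuous
    have hB : MeasurableSet B := by
      refine (isOpen_lt continuous_const ?_).measurableSet
      have h1 := (continuous_agdStep (blk := blk) hg p.η).iterate ⌈p.tth⌉₊
      fun_prop
    calc _ ≤ P {ω | ∃ t x, PerturbsAt p blk f x₀ (fun t => ξ t ω) t x ∧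
          uniformBall d p.r (Prod.mk x ⁻¹' B) ≤ ENNReal.ofReal (3 / m) ∧ (x, ξ t ω) ∈ B} := by
          refine measure_mono ?_
          rintro ω ⟨t, x, hx, hnot, hst⟩
          obtain ⟨h1, -, v, hv, hvH⟩ := hsaddle _ t x hx hnot
          exact ⟨t, x, hx, uniformBall_stuck_le hp hpd hpL h hH hΔ hm hm' h1 hv hvH, hst⟩
      _ ≤ ENNReal.ofReal (3 / m) * ENNReal.ofReal ((f x₀ - fstar) / p.fth + 1) :=
          measure_exists_perturbsAt_le hR hf hg hfs hξ hind hν hB _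
      _ ≤ ENNReal.ofReal p.δ := by
          rw [← ENNReal.ofReal_mul (by positivity), ← hpΔ]
          exact ENNReal.ofReal_le_ofReal hmδ
  · refine le_of_eq_of_le (measure_mono_null (t := ∅) ?_ measure_empty) zero_le
    rintro ω ⟨t, x, hx, hnot, -⟩
    obtain ⟨-, hxΔ, v, hv, hvH⟩ := hsaddle _ t x hx hnot
    exact absurd (fth_le_of_saddle hp hH hfs hxΔ hv hvH) hΔ

end

theorem theorem1 :
    ∃ cmax : ℝ, 0 < cmax ∧ ∀ c : ℝ, 0 < c → c ≤ cmax →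
      ∃ C : ℝ, 0 < C ∧
        ∀ (d : ℕ) (blk : Fin d → Fin 2), Function.Surjective blk →
        ∀ (f : EuclideanSpace ℝ (Fin d) → ℝ) (L ρ : ℝ) (Lb Lt : Fin 2 → ℝ),
          IsLSmooth f L → IsBlockSmooth blk f Lb Lt → IsHessianLipschitz f ρ →
          0 < blockLmax Lb Lt → blockLmax Lb Lt ≤ L → 0 < ρ →
        ∀ (fstar : ℝ), IsGLB (Set.range f) fstar →
        ∀ (x₀ : EuclideanSpace ℝ (Fin d)) (ε δ : ℝ),
          0 < ε → ε ≤ blockLmax Lb Lt ^ 2 / ρ → 0 < δ → δ ≤ 1 →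
        ∀ (p : PAGDParams),
          p = { d := d, c := c, Lmax := blockLmax Lb Lt, L := L, ρ := ρ, ε := ε, δ := δ,
                Δ := f x₀ - fstar } →
        ∀ (Ω : Type*) [MeasurableSpace Ω] (P : Measure Ω) [IsProbabilityMeasure P]
          (ξ : ℕ → Ω → EuclideanSpace ℝ (Fin d)),
          iIndepFun ξ P → (∀ t, HasLaw (ξ t) (uniformBall d p.r) P) →
          ENNReal.ofReal (1 - δ) ≤
            P {ω | ∃ (T : ℕ) (x : EuclideanSpace ℝ (Fin d)),
                pagdRun p blk f x₀ (fun t => ξ t ω) T = Sum.inr x ∧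
                IsSS2 f ε ((blockLmax Lb Lt * ρ * ε) ^ ((1 : ℝ) / 3)) x ∧
                (T : ℝ) ≤ C * (p.rate * max p.logFactor 4 ^ 7 + p.tth) ∧
                (ε ^ 2 / blockLmax Lb Lt ≤ f x₀ - fstar →
                  (T : ℝ) ≤ C * (p.rate * p.logFactor ^ 7))} := by
  refine ⟨1 / 10000, by norm_num, fun c hc hcmax => ?_⟩
  refine ⟨3 * 6 ^ 7 / c ^ 7 * (1 + 6 / c ^ 2), by positivity, ?_⟩
  intro d blk hblk f L ρ Lb Lt _ h hH hL hLL hρ fstar hfstar x₀ ε δ hε hε' hδ hδ' p hpeq Ω _ P _ ξ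
    hind hlaw
  have hfs : ∀ y, fstar ≤ f y := fun y => hfstar.1 ⟨y, rfl⟩
  have hp : p.Admissible := by
    subst hpeq
    exact ⟨(hblk 0).choose.pos, hc, hcmax, hL, hLL, hρ, hε, hε', hδ, hδ',
      by simpa using hfs x₀⟩
  have hpc : p.c = c := by rw [hpeq]
  have hpd : p.d = d := by rw [hpeq]
  have hpL : p.Lmax = blockLmax Lb Lt := by rw [hpeq]
  have hpρ : p.ρ = ρ := by rw [hpeq]
  have hpε : p.ε = ε := by rw [hpeq]
  have hpδ : p.δ = δ := by rw [hpeq]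
  have hpΔ : p.Δ = f x₀ - fstar := by rw [hpeq]
  clear hpeq
  subst hpc hpρ hpε hpδ
  rw [← hpL, ← hpΔ]
  set ζ : ℕ → Ω → EuclideanSpace ℝ (Fin d) := fun t => (hlaw t).aemeasurable.mk (ξ t) with hζ
  have hζm : ∀ t, Measurable (ζ t) := fun t => (hlaw t).aemeasurable.measurable_mk
  have hζξ : ∀ t, ξ t =ᵐ[P] ζ t := fun t => (hlaw t).aemeasurable.ae_eq_mk
  have hζind : iIndepFun ζ P := hind.congr hζξ
  have hζlaw : ∀ t, P.map (ζ t) = uniformBall d p.r := fun t => by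
    rw [← Measure.map_congr (hζξ t), (hlaw t).map_eq]
  have hbad := measure_not_isSS2_le hp hpd hpL h hH hfs hpΔ hζm hζind hζlaw
  have hR := h.runRegular hp hpL
  set G := {ω | ∃ (T : ℕ) (x : EuclideanSpace ℝ (Fin d)),
    pagdRun p blk f x₀ (fun t => ξ t ω) T = Sum.inr x ∧
    IsSS2 f p.ε ((p.Lmax * p.ρ * p.ε) ^ ((1 : ℝ) / 3)) x ∧
    (T : ℝ) ≤ 3 * 6 ^ 7 / p.c ^ 7 * (1 + 6 / p.c ^ 2) *
      (p.rate * max p.logFactor 4 ^ 7 + p.tth) ∧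
    (p.ε ^ 2 / p.Lmax ≤ p.Δ →
      (T : ℝ) ≤ 3 * 6 ^ 7 / p.c ^ 7 * (1 + 6 / p.c ^ 2) * (p.rate * p.logFactor ^ 7))} with hG
  have hGc : P Gᶜ ≤ ENNReal.ofReal p.δ := by
    refine le_trans (measure_mono_ae ?_) hbad
    filter_upwards [ae_all_iff.2 hζξ] with ω hω hωG
    have hfun : (fun t => ζ t ω) = fun t => ξ t ω := funext fun t => (hω t).symm
    obtain ⟨T, tp, x, hT, hTle, -, hx, hstuck⟩ := hR.exists_return hfs x₀ (fun t => ξ t ω)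
    refine ⟨tp, x, by rw [hfun]; exact hx, fun hSS => hωG ?_, by rw [← hω]; exact hstuck⟩
    rw [← hpΔ] at hTle
    have hT1 := hp.iteration_bound_le hTle
    have hrate : 0 ≤ p.rate := by
      have := hp.Δ_nonneg
      obtain ⟨h1, h2, h3, h4, h5, h6, h7, h8, h9⟩ := hp.pos_all
      rw [hp.rate_eq]; positivity
    have htth := hp.pos_derived.2.2.2.2
    have hmax : 0 ≤ max p.logFactor 4 := le_max_of_le_right (by norm_num)
    refine ⟨T, x, hT, hSS, hT1.trans ?_, fun hΔ => hT1.trans ?_⟩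
    · have : 0 ≤ p.rate * max p.logFactor 4 ^ 7 + p.tth := by positivity
      gcongr
      exact le_mul_of_one_le_right (by positivity) (le_add_of_nonneg_right (by positivity))
    · rw [max_eq_left (hp.four_le_logFactor hΔ), mul_assoc]
      gcongr
      have := hp.tth_le_of_le_Δ hΔ
      linarith
  have h1 : (1 : ENNReal) ≤ P G + P Gᶜ := by
    rw [← measure_univ (μ := P), ← Set.union_compl_self G]
    exact measure_union_le _ _
  rw [ENNReal.ofReal_sub _ hp.δ_pos.le, ENNReal.ofReal_one, tsub_le_iff_right]
  exact h1.trans (by gcongr)
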